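/- Let $d\ge 2$, $N\ge 2$ and $1\le L\le N-1$, and consider $N$ parties $A_1,\dots,A_N$ each holding a qudit $\mathbb{C}^d$ with standard basis $|0\rangle,\dots,|d-1\rangle$. Put $|\mathrm{GHZ}_{N,d}\rangle=\frac{1}{\sqrt d}\sum_i|i\rangle^{\otimes N}$, $\mathcal P_{M,d}=\sum_i(|i\rangle\langle i|)^{\otimes M}$, $|\psi_{ij}\rangle=\frac1{\sqrt2}\big(|i\rangle^{\otimes L}|j\rangle^{\otimes (N-L)}-|j\rangle^{\otimes L}|i\rangle^{\otimes (N-L)}\big)$, and for $0\le p\le 1$ $$\sigma(p)=p\,|\mathrm{GHZ}_{N,d}\rangle\langle \mathrm{GHZ}_{N,d}|+(1-p)\frac{\mathcal P_{L,d}\otimes\mathcal P_{N-L,d}}{d^2},\qquad \sigma'(p)=p\,\frac{2}{d(d-1)}\sum_{i<j}|\psi_{ij}\rangle\langle\psi_{ij}|+(1-p)\frac{\mathcal P_{L,d}\otimes\mathcal P_{N-L,d}}{d^2}.$$ A state is *$K$-separable* if it is a probabilistic mixture of states each of which is, for some partition of the parties into $K$ nonempty groups $S_1,\dots,S_K$,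 a mixture of pure states of the form $\bigotimes_k|\psi_{S_k}\rangle\langle\psi_{S_k}|$; it is *genuinely multipartite entangled* (GME) if it is not $K$-separable for any $K\ge2$. A state $\rho$ is *bilocal with respect to the bipartition* $S|\bar S$ if there are a probability space $(\Lambda,\omega)$ and response functions $p_S,p_{\bar S}$ (for each choice of local measurements and each $\lambda\in\Lambda$, probability distributions over the joint outcomes of the group, depending only on the measurements of that group and on $\lambda$) such that for all generalized measurements (POVMs) $M_n=\{M^{(n)}_{a}\}_a$ with finitely many outcomes, $n=1,\dots,N$, and all outcomes $a_1,\dots,a_N$, $$\mathrm{Tr}\Big[\Big(\bigotimes_{n}M^{(n)}_{a_n}\Big)\rho\Big]=\int_\Lambda p_S(a_S\,|\,M_S,\lambda)\,p_{\bar S}(a_{\bar S}\,|\,M_{\bar S},\lambda)\,d\omega(\lambda).$$ Then: 1. For $0\le p\le1$, $\sigma(p)$ and $\sigma'(p)$ are states, and $\sigma(p)=(V_L\otimes V_{N-L})\,\rho_{\mathrm{iso}}(p)\,(V_L\otimes V_{N-L})^\dagger$, $\sigma'(p)=(V_L\otimes V_{N-L})\,\rho_{W}(p)\,(V_L\otimes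 V_{N-L})^\dagger$, where $V_M|i\rangle=|i\rangle^{\otimes M}$, $\rho_{\mathrm{iso}}(p)=p|\psi_d^+\rangle\langle\psi_d^+|+(1-p)\mathbb 1/d^2$ with $|\psi_d^+\rangle=\frac1{\sqrt d}\sum_i|ii\rangle$ is the isotropic state, and $\rho_W(p)=p\frac{2}{d(d-1)}P_{\mathrm{asym}}+(1-p)\mathbb 1/d^2$ is the Werner state, $P_{\mathrm{asym}}$ being the projector onto the antisymmetric subspace of $\mathbb C^d\otimes\mathbb C^d$. 2. For $\frac1{d+1}<p\le1$, both $\sigma(p)$ and $\sigma'(p)$ are GME. 3. For $0\le p\le \frac{(3d-1)(d-1)^{d-1}}{d^d(d+1)}$, both $\sigma(p)$ and $\sigma'(p)$ are bilocal with respect to the bipartition $A_1\dots A_L|A_{L+1}\dots A_N$. 4. $\frac1{d+1}<\frac{(3d-1)(d-1)^{d-1}}{d^d(d+1)}$, so that the two ranges overlap. -/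

import Mathlib

open scoped ComplexOrder

noncomputable section

namespace Multipartite

/-- Operators on the Hilbert space of a family `ι` of qudits, `⨂_{n : ι} ℂ^d`, written as matrices
in the product basis `|x⟩ = ⨂_n |x n⟩`, `x : ι → Fin d`. -/
abbrev Op (ι : Type) (d : ℕ) : Type := Matrix (ι → Fin d) (ι → Fin d) ℂ

/-- The rank-one operator `|ψ⟩⟨ψ|`. -/
def proj {X : Type} (ψ : X → ℂ) : Matrix X X ℂ := Matrix.vecMulVec ψ (star ψ)

/-- The basis vector `|x⟩`. -/
def ket {X : Type} [DecidableEq X] (x : X) : X → ℂ := Pi.single x 1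

/-- A density operator (quantum state). -/
def IsDensity {X : Type} [Fintype X] (ρ : Matrix X X ℂ) : Prop :=
  ρ.PosSemidef ∧ ρ.trace = 1

/-- A pure state: a vector of unit Euclidean norm. -/
def IsPure {X : Type} [Fintype X] (ψ : X → ℂ) : Prop := ∑ x, ‖ψ x‖ ^ 2 = 1

/-- A `K`-partition of the `N` parties is given by a surjective map `c : Fin N → Fin K`;
`Group c k` is the `k`-th group `S_k` of parties. -/
abbrev Group {N K : ℕ} (c : Fin N → Fin K) (k : Fin K) : Type := {n : Fin N // c n = k}

/-- The tensor product `⨂_k A_k` of operators `A_k` acting on the groups of a partition. -/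
def groupTensor {N K d : ℕ} (c : Fin N → Fin K) (A : (k : Fin K) → Op (Group c k) d) :
    Op (Fin N) d :=
  Matrix.of fun x y => ∏ k, A k (fun n => x n) (fun n => y n)

/-! ### Separability and genuine multipartite entanglement -/

/-- States separable with respect to the partition `c`: mixtures of `⨂_k |ψ_k⟩⟨ψ_k|` with pure
states `ψ_k` of the groups `S_k`. -/
def separableWrt {N K : ℕ} (d : ℕ) (c : Fin N → Fin K) : Set (Op (Fin N) d) :=
  convexHull ℝ {ρ | ∃ ψ : (k : Fin K) → ((Group c k → Fin d) → ℂ),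
    (∀ k, IsPure (ψ k)) ∧ ρ = groupTensor c fun k => proj (ψ k)}

/-- `K`-separability: a probabilistic mixture of states separable with respect to (possibly
different) `K`-partitions. -/
def IsKSeparable {N d : ℕ} (K : ℕ) (ρ : Op (Fin N) d) : Prop :=
  ρ ∈ convexHull ℝ {σ | ∃ c : Fin N → Fin K, Function.Surjective c ∧ σ ∈ separableWrt d c}

/-- Genuinely multipartite entangled states: states that are not `K`-separable for any `K ≥ 2`. -/
def IsGME {N d : ℕ} (ρ : Op (Fin N) d) : Prop :=
  IsDensity ρ ∧ ∀ K : ℕ, 2 ≤ K → ¬ IsKSeparable K ρ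

/-! ### Locality for generalized measurements -/

/-- A generalized measurement (POVM) on a qudit. -/
structure POVM (d : ℕ) where
  /-- the number of outcomes -/
  outcomes : ℕ
  /-- the measurement operators -/
  op : Fin outcomes → Matrix (Fin d) (Fin d) ℂ
  posSemidef : ∀ a, (op a).PosSemidef
  sum_eq_one : ∑ a, op a = 1

/-- The operator `⨂_n M^{(n)}_{a_n}`. -/
def measurementOp {N d : ℕ} (M : Fin N → POVM d) (a : (n : Fin N) → Fin (M n).outcomes) :
    Op (Fin N) d :=
  Matrix.of fun x y => ∏ n, (M n).op (a n) (x n) (y n)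

/-- `ρ` has a model for generalized measurements that is local with respect to the partition `c`:
there are a probability space `(Λ, ω)` of classical information and, for each group `S_k`, a
response function `p k`, where `p k M a lam` is the probability that the parties in `S_k` obtain
the joint outcome `a` upon measuring `M` when the classical information is `lam`, such that
`Tr[(⨂_n M^{(n)}_{a_n}) ρ] = ∫ ∏_k p_k(a_{S_k} | M_{S_k}, lam) dω(lam)`
for all measurements of all parties and all outcomes.
The measure `ω` does not depend on the measurements, and `p k` sees only those of its group. -/
def IsLocalWrt {N K d : ℕ} (c : Fin N → Fin K) (ρ : Op (Fin N) d) : Prop :=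
  ∃ (Λ : Type) (_ : MeasurableSpace Λ) (ω : MeasureTheory.Measure Λ)
    (p : (k : Fin K) → (M : Group c k → POVM d) →
      ((n : Group c k) → Fin (M n).outcomes) → Λ → ℝ),
    MeasureTheory.IsProbabilityMeasure ω ∧
    (∀ k M a, Measurable (p k M a)) ∧
    (∀ k M a lam, 0 ≤ p k M a lam) ∧
    (∀ k M lam, ∑ a, p k M a lam = 1) ∧
    ∀ (M : Fin N → POVM d) (a : (n : Fin N) → Fin (M n).outcomes),
      (measurementOp M a * ρ).trace =
        ((∫ lam, ∏ k, p k (fun n => M n) (fun n => a n) lam ∂ω : ℝ) : ℂ)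

/-- The bipartition `A_1 … A_L | A_{L+1} … A_N`. -/
def cut (N L : ℕ) : Fin N → Fin 2 := fun n => if n.val < L then 0 else 1

/-! ### The states -/

/-- The basis vector `|i⟩^{⊗ L} |j⟩^{⊗ (N - L)}`. -/
def ketRep {d : ℕ} (N L : ℕ) (i j : Fin d) : (Fin N → Fin d) → ℂ :=
  ket fun n => if n.val < L then i else j

/-- `|GHZ_{N,d}⟩ = (1/√d) ∑_i |i⟩^{⊗ N}`. -/
def ghz (N d : ℕ) : (Fin N → Fin d) → ℂ :=
  ((1 / √(d : ℝ) : ℝ) : ℂ) • ∑ i : Fin d, ket (fun _ => i)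

/-- `𝒫 = ∑_i (|i⟩⟨i|)^{⊗ ι}` on a family `ι` of qudits. -/
def repProj (ι : Type) [Fintype ι] [DecidableEq ι] (d : ℕ) : Op ι d :=
  ∑ i : Fin d, proj (ket fun _ => i)

/-- The coloured noise `𝒫_{L,d} ⊗ 𝒫_{N-L,d} / d²`. -/
def colouredNoise (N L d : ℕ) : Op (Fin N) d :=
  (1 / (d : ℝ) ^ 2) • groupTensor (cut N L) fun _ => repProj _ d

/-- `σ(p) = p |GHZ⟩⟨GHZ| + (1 - p) 𝒫_{L,d} ⊗ 𝒫_{N-L,d} / d²`. -/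
def ghzState (N L d : ℕ) (p : ℝ) : Op (Fin N) d :=
  p • proj (ghz N d) + (1 - p) • colouredNoise N L d

/-- `ψ_{ij} = (1/√2) (|i⟩^{⊗ L} |j⟩^{⊗ (N - L)} - |j⟩^{⊗ L} |i⟩^{⊗ (N - L)})`. -/
def antiVec {d : ℕ} (N L : ℕ) (i j : Fin d) : (Fin N → Fin d) → ℂ :=
  ((1 / √(2 : ℝ) : ℝ) : ℂ) • (ketRep N L i j - ketRep N L j i)

/-- `σ'(p) = p (2 / (d (d - 1))) ∑_{i<j} |ψ_{ij}⟩⟨ψ_{ij}| + (1 - p) 𝒫_{L,d} ⊗ 𝒫_{N-L,d} / d²`. -/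
def wernerGenState (N L d : ℕ) (p : ℝ) : Op (Fin N) d :=
  p • ((2 / ((d : ℝ) * ((d : ℝ) - 1))) •
      ∑ i : Fin d, ∑ j : Fin d with i < j, proj (antiVec N L i j))
    + (1 - p) • colouredNoise N L d

/-! ### Their bipartite origin -/

/-- The maximally entangled vector `(1/√d) ∑_i |ii⟩`. -/
def maxEnt (d : ℕ) : Fin d × Fin d → ℂ :=
  ((1 / √(d : ℝ) : ℝ) : ℂ) • ∑ i : Fin d, ket (i, i)

/-- The two-qudit isotropic state. -/
def isotropic (d : ℕ) (p : ℝ) : Matrix (Fin d × Fin d) (Fin d × Fin d) ℂ :=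
  p • proj (maxEnt d) + (1 - p) • (1 / (d : ℝ) ^ 2) • 1

/-- The swap operator `|ij⟩ ↦ |ji⟩`. -/
def swapOp (d : ℕ) : Matrix (Fin d × Fin d) (Fin d × Fin d) ℂ :=
  Matrix.of fun x y => if x = y.swap then 1 else 0

/-- The projector onto the antisymmetric subspace of `ℂ^d ⊗ ℂ^d`. -/
def asymProj (d : ℕ) : Matrix (Fin d × Fin d) (Fin d × Fin d) ℂ :=
  (1 / 2 : ℝ) • (1 - swapOp d)

/-- The two-qudit Werner state. -/
def werner (d : ℕ) (p : ℝ) : Matrix (Fin d × Fin d) (Fin d × Fin d) ℂ :=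
  p • (2 / ((d : ℝ) * ((d : ℝ) - 1))) • asymProj d + (1 - p) • (1 / (d : ℝ) ^ 2) • 1

/-- The matrix of the isometry `V|i⟩ = |i⟩^{⊗ ι}`. -/
def copyIso (ι : Type) [Fintype ι] (d : ℕ) : Matrix (ι → Fin d) (Fin d) ℂ :=
  Matrix.of fun x i => if x = fun _ => i then 1 else 0

/-- The matrix of the isometry `V_L ⊗ V_{N-L}`. -/
def cutIso (N L d : ℕ) : Matrix (Fin N → Fin d) (Fin d × Fin d) ℂ :=
  Matrix.of fun x ij =>
    copyIso (Group (cut N L) 0) d (fun n => x n) ij.1 *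
      copyIso (Group (cut N L) 1) d (fun n => x n) ij.2

/-- The `N`-partite operator `(V_L ⊗ V_{N-L}) ρ (V_L ⊗ V_{N-L})†` obtained from a two-qudit `ρ`. -/
def extend (N L : ℕ) {d : ℕ} (ρ : Matrix (Fin d × Fin d) (Fin d × Fin d) ℂ) : Op (Fin N) d :=
  cutIso N L d * ρ * (cutIso N L d).conjTranspose

/-- The locality threshold `(3d-1)(d-1)^{d-1} / (d^d (d+1))`. -/
def localThreshold (d : ℕ) : ℝ :=
  (3 * (d : ℝ) - 1) * ((d : ℝ) - 1) ^ (d - 1) / ((d : ℝ) ^ d * ((d : ℝ) + 1))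

end Multipartite

end

/-!
Both families are images `V ρ V†` of a two-qudit state `ρ` (isotropic or Werner) under the isometry
`V = V_L ⊗ V_(N-L)`, where `V_M |i⟩ = |i⟩^{⊗ M}` (`ghzState_eq_extend`,
`wernerGenState_eq_extend`). The four claims are then as follows.

*States.* Conjugation by an isometry preserves density operators.

*Genuine multipartite entanglement.* A pure state that is a product for a partition into `K ≥ 2`
groups is a product across one bipartition, one group against the rest. A real-linear functional
bounded on all such products is bounded on all `K`-separable states (`le_of_isKSeparable`). For
`σ(p)` the functional is, up to a factor `d`, the fidelity with the GHZ vector, which by the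
Cauchy-Schwarz inequality is at most `1 / d` on a product across any bipartition. For `σ'(p)` it is
minus the sum of the swap of the two sides of the cut and the projector onto the complement of the
range of `V`. On a product across the cut the swap is nonnegative; on a product across any other
bipartition, negative contributions of the swap are compensated by weight outside the range of `V`
(`IsBiproduct.swap_nonneg_of_not_split`, `IsBiproduct.swap_add_nonneg_of_split`). The two states
exceed these bounds exactly for `p > 1 / (d + 1)`.

*Bilocality.* Measuring the parties of one group amounts to measuring the POVM `V_M† (⨂ M_n) V_M` on
one qudit, whose effects are entrywise products (`groupEffect`), so a local model for `ρ` suffices.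
This is Barrett's model: the hidden variable is a uniformly random unit vector `z`; the first side
refines its effects to rank-one effects `e |v⟩⟨v|`, answers with probability `e t` if `t = |⟨v|z⟩|²`
exceeds `1 / d`, and else draws an outcome at random (`alice`); the second side answers by the Born
rule in the state conjugate to `z` (isotropic) or in the normalized projector orthogonal to `z`
(Werner). The hidden vector is realized as the direction of a complex Gaussian vector (`haarVec`),
whose unitary invariance determines the correlations up to the mean of `(d t - 1) t` over `t > 1 /
d` (`integral_weight_mul_quad`). As `t` exceeds `s` with probability `(1 - s) ^ (d - 1)`
(`haarVec_tail`), the layer-cake formula gives the value of that mean (`integral_threshold`), and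
with it the threshold. Smaller `p` are reached by letting the first side ignore the hidden vector
more often.

*Overlap.* The inequality reduces to `(1 + 1 / n) ^ n < 3 - 1 / (n + 1)` for `n = d - 1`.
-/

namespace Multipartite

open Matrix MeasureTheory
open scoped Kronecker

/-! ### The states as images of two-qudit states -/

/-- The label `i^L j^(N-L)` of the basis vector `ketRep N L i j`. -/
def cutPt (N L : ℕ) {d : ℕ} (i j : Fin d) : Fin N → Fin d := fun n => if n.val < L then i else j

theorem cutPt_injective {N L d : ℕ} (hL : 1 ≤ L) (hLN : L + 1 ≤ N) {i j i' j' : Fin d}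
    (h : cutPt N L i j = cutPt N L i' j') : i = i' ∧ j = j' := by
  have h0 := congrFun h ⟨0, by omega⟩
  have h1 := congrFun h ⟨L, by omega⟩
  simp only [cutPt, lt_irrefl, if_false] at h0 h1
  exact ⟨by simpa [show 0 < L by omega] using h0, h1⟩

theorem cut_eq_zero_iff {N L : ℕ} (n : Fin N) : cut N L n = 0 ↔ n.val < L := by
  unfold cut; split_ifs with h <;> simp [h]

theorem cut_eq_one_iff {N L : ℕ} (n : Fin N) : cut N L n = 1 ↔ ¬ n.val < L := by
  unfold cut; split_ifs with h <;> simp [h]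

theorem cutIso_apply {N L d : ℕ} (x : Fin N → Fin d) (ij : Fin d × Fin d) :
    cutIso N L d x ij = if x = cutPt N L ij.1 ij.2 then 1 else 0 := by
  simp only [cutIso, copyIso, of_apply, ← ite_and, mul_ite, mul_one, mul_zero]
  congr 1
  rw [eq_iff_iff]
  constructor
  · rintro ⟨h1, h0⟩
    funext n
    by_cases hn : n.val < L
    · simpa [cutPt, hn] using congrFun h0 ⟨n, (cut_eq_zero_iff n).2 hn⟩
    · simpa [cutPt, hn] using congrFun h1 ⟨n, (cut_eq_one_iff n).2 hn⟩
  · rintro rfl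
    constructor <;> funext n
    · simp [cutPt, (cut_eq_one_iff n.1).1 n.2]
    · simp [cutPt, (cut_eq_zero_iff n.1).1 n.2]

theorem cutIso_isometry {N L : ℕ} (d : ℕ) (hL : 1 ≤ L) (hLN : L + 1 ≤ N) :
    (cutIso N L d)ᴴ * cutIso N L d = 1 := by
  ext a b
  rw [mul_apply, one_apply]
  simp only [conjTranspose_apply, cutIso_apply]
  rw [Finset.sum_eq_single (cutPt N L a.1 a.2)]
  · by_cases hab : a = b
    · simp [hab]
    · have : cutPt N L a.1 a.2 ≠ cutPt N L b.1 b.2 := fun h =>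
        hab (Prod.ext (cutPt_injective hL hLN h).1 (cutPt_injective hL hLN h).2)
      simp [hab, this]
  · intro x _ hx; simp [hx]
  · simp

theorem mul_proj_mul_conjTranspose {X Y : Type} [Fintype X] (A : Matrix Y X ℂ) (ψ : X → ℂ) :
    A * proj ψ * Aᴴ = proj (A *ᵥ ψ) := by
  rw [proj, proj, mul_vecMulVec, vecMulVec_mul, star_mulVec]

theorem cutIso_mulVec_ket {N L d : ℕ} (i j : Fin d) :
    cutIso N L d *ᵥ ket (i, j) = ketRep N L i j := by
  funext x
  simp only [ket, mulVec_single_one, col_apply, cutIso_apply, ketRep, Pi.single_apply]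
  rfl

theorem ghz_eq_mulVec (N L d : ℕ) : ghz N d = cutIso N L d *ᵥ maxEnt d := by
  simp only [ghz, maxEnt, mulVec_smul, mulVec_sum, cutIso_mulVec_ket, ketRep, ite_self]

theorem proj_ket_apply {X : Type} [DecidableEq X] (z x y : X) :
    proj (ket z) x y = if x = z ∧ y = z then 1 else 0 := by
  simp only [proj, vecMulVec_apply, ket, Pi.single_apply, Pi.star_apply]
  by_cases hx : x = z <;> by_cases hy : y = z <;> simp [hx, hy]

theorem repProj_eq (ι : Type) [Fintype ι] [DecidableEq ι] (d : ℕ) :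
    repProj ι d = copyIso ι d * (copyIso ι d)ᴴ := by
  ext x y
  rw [repProj, Matrix.sum_apply, mul_apply]
  refine Finset.sum_congr rfl fun i _ => ?_
  rw [proj_ket_apply, conjTranspose_apply]
  simp only [copyIso, of_apply]
  by_cases hx : x = fun _ => i <;> by_cases hy : y = fun _ => i <;> simp [hx, hy]

theorem groupTensor_repProj (N L d : ℕ) :
    groupTensor (cut N L) (fun _ => repProj _ d) = extend N L (1 : Matrix (Fin d × Fin d) _ ℂ) := by
  ext x y
  simp only [groupTensor, extend, Matrix.mul_one, of_apply, Fin.prod_univ_two, repProj_eq,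
    mul_apply, Finset.sum_mul_sum, Fintype.sum_prod_type, conjTranspose_apply, cutIso, star_mul']
  refine Finset.sum_congr rfl fun i _ => Finset.sum_congr rfl fun j _ => ?_
  ring

theorem extend_add (N L : ℕ) {d : ℕ} (ρ σ : Matrix (Fin d × Fin d) (Fin d × Fin d) ℂ) :
    extend N L (ρ + σ) = extend N L ρ + extend N L σ := by
  simp [extend, Matrix.mul_add, Matrix.add_mul]

theorem extend_smul (N L : ℕ) {d : ℕ} (r : ℝ) (ρ : Matrix (Fin d × Fin d) (Fin d × Fin d) ℂ) :
    extend N L (r • ρ) = r • extend N L ρ := by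
  simp [extend]

theorem extend_sum (N L : ℕ) {d : ℕ} {α : Type*} (s : Finset α)
    (ρ : α → Matrix (Fin d × Fin d) (Fin d × Fin d) ℂ) :
    extend N L (∑ a ∈ s, ρ a) = ∑ a ∈ s, extend N L (ρ a) := by
  simp [extend, Matrix.mul_sum, Matrix.sum_mul]

theorem ghzState_eq_extend (N L d : ℕ) (p : ℝ) :
    ghzState N L d p = extend N L (isotropic d p) := by
  rw [ghzState, isotropic, extend_add, extend_smul, extend_smul, extend_smul, colouredNoise,
    groupTensor_repProj, ghz_eq_mulVec N L, ← mul_proj_mul_conjTranspose]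
  rfl

/-- The two-qudit singlet `(|ij⟩ - |ji⟩)/√2`. -/
noncomputable def singlet {d : ℕ} (i j : Fin d) : Fin d × Fin d → ℂ :=
  ((1 / √(2 : ℝ) : ℝ) : ℂ) • (ket (i, j) - ket (j, i))

theorem antiVec_eq_mulVec {N L d : ℕ} (i j : Fin d) :
    antiVec N L i j = cutIso N L d *ᵥ singlet i j := by
  simp only [antiVec, singlet, mulVec_smul, mulVec_sub, cutIso_mulVec_ket]

theorem proj_smul {X : Type} (r : ℝ) (ψ : X → ℂ) : proj ((r : ℂ) • ψ) = (r ^ 2) • proj ψ := by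
  ext x y
  simp only [proj, vecMulVec_apply, Pi.smul_apply, Matrix.smul_apply, Pi.star_apply, smul_eq_mul,
    star_mul', Complex.real_smul, Complex.ofReal_pow, RCLike.star_def, Complex.conj_ofReal]
  ring

theorem sum_sum_lt_of_symm {d : ℕ} {M : Type*} [AddCommMonoid M] (f : Fin d → Fin d → M)
    (hs : ∀ i j, f i j = f j i) (h0 : ∀ i, f i i = 0) :
    ∑ i, ∑ j, f i j = 2 • ∑ i : Fin d, ∑ j : Fin d with i < j, f i j := by
  have h1 : ∀ i j, f i j = (if i < j then f i j else 0) + (if j < i then f i j else 0) := by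
    intro i j
    rcases lt_trichotomy i j with h | h | h
    · simp [h, h.not_gt]
    · subst h; simp [h0]
    · simp [h, h.not_gt]
  simp only [Finset.sum_filter]
  rw [two_nsmul]
  nth_rewrite 2 [Finset.sum_comm]
  rw [← Finset.sum_add_distrib]
  refine Finset.sum_congr rfl fun i _ => ?_
  rw [← Finset.sum_add_distrib]
  refine Finset.sum_congr rfl fun j _ => ?_
  rw [h1 i j, hs j i]
  rcases lt_trichotomy i j with h | h | h
  · simp [h, h.not_gt]
  · subst h; simp
  · simp [h, h.not_gt]

theorem asymProj_eq_sum (d : ℕ) :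
    asymProj d = ∑ i : Fin d, ∑ j : Fin d with i < j, proj (singlet i j) := by
  have h := sum_sum_lt_of_symm (fun i j : Fin d => proj (singlet i j))
    (fun i j => by
      have : singlet i j = ((-1 : ℝ) : ℂ) • singlet j i := by
        simp only [singlet, smul_comm ((-1 : ℝ) : ℂ)]
        simp
      rw [this, proj_smul]; simp)
    (fun i => by ext; simp [singlet, proj])
  have hu : ∀ i j : Fin d, proj (singlet i j) = (1 / 2 : ℝ) •
      (single (i, j) (i, j) 1 - single (i, j) (j, i) 1
        - single (j, i) (i, j) 1 + single (j, i) (j, i) 1) := by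
    intro i j
    rw [singlet, proj_smul, div_pow, Real.sq_sqrt zero_le_two, one_pow]
    simp only [proj, ket, star_sub, Pi.star_single, star_one, sub_vecMulVec, vecMulVec_sub,
      ← single_eq_single_vecMulVec_single]
    congr 1
    abel
  have h1 : ∑ i : Fin d, ∑ j : Fin d, single (i, j) (i, j) (1 : ℂ) = 1 := by
    rw [← Fintype.sum_prod_type' (f := fun i j : Fin d => single (i, j) (i, j) (1 : ℂ))]
    ext x y
    simp [Matrix.sum_apply, single_apply, one_apply, ite_and]
  have hs : ∑ i : Fin d, ∑ j : Fin d, single (i, j) (j, i) (1 : ℂ) = swapOp d := by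
    rw [← Fintype.sum_prod_type' (f := fun i j : Fin d => single (i, j) (j, i) (1 : ℂ))]
    ext x y
    simp only [Matrix.sum_apply, single_apply, ite_and, Prod.mk.eta, swapOp, of_apply,
      Finset.sum_ite_eq', Finset.mem_univ, if_true]
    simp only [Prod.ext_iff, Prod.fst_swap, Prod.snd_swap]
    grind
  have h2 : (2 : ℝ) • asymProj d = ∑ i : Fin d, ∑ j : Fin d, proj (singlet i j) := by
    simp only [hu, ← Finset.smul_sum, Finset.sum_add_distrib, Finset.sum_sub_distrib]
    rw [Finset.sum_comm (f := fun i j : Fin d => single (j, i) (j, i) (1 : ℂ)),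
      Finset.sum_comm (f := fun i j : Fin d => single (j, i) (i, j) (1 : ℂ)), h1, hs, asymProj]
    module
  have h3 := h2.trans h
  rw [← Nat.cast_smul_eq_nsmul ℝ] at h3
  exact smul_right_injective _ (two_ne_zero (α := ℝ)) (by simpa using h3)

theorem wernerGenState_eq_extend (N L d : ℕ) (p : ℝ) :
    wernerGenState N L d p = extend N L (werner d p) := by
  rw [wernerGenState, werner, extend_add]
  simp only [extend_smul, asymProj_eq_sum, extend_sum]
  rw [colouredNoise, groupTensor_repProj]
  simp only [antiVec_eq_mulVec, ← mul_proj_mul_conjTranspose]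
  rfl

theorem proj_posSemidef {X : Type} [Fintype X] (ψ : X → ℂ) : (proj ψ).PosSemidef :=
  posSemidef_vecMulVec_self_star ψ

theorem IsDensity.extend {N L d : ℕ} (hL : 1 ≤ L) (hLN : L + 1 ≤ N)
    {ρ : Matrix (Fin d × Fin d) (Fin d × Fin d) ℂ} (h : IsDensity ρ) :
    IsDensity (extend N L ρ) := by
  refine ⟨h.1.mul_mul_conjTranspose_same _, ?_⟩
  rw [Multipartite.extend, Matrix.mul_assoc, trace_mul_comm, Matrix.mul_assoc,
    cutIso_isometry d hL hLN, Matrix.mul_one, h.2]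

theorem maxEnt_eq (d : ℕ) : maxEnt d =
    ((1 / √(d : ℝ) : ℝ) : ℂ) • fun x : Fin d × Fin d => if x.1 = x.2 then (1 : ℂ) else 0 := by
  rw [maxEnt]
  congr 1
  funext x
  rw [Finset.sum_apply]
  simp only [ket, Pi.single_apply, Prod.ext_iff, ite_and, Finset.sum_ite_eq,
    Finset.mem_univ, if_true]
  grind

theorem isDensity_isotropic {d : ℕ} (hd : 2 ≤ d) {p : ℝ} (h0 : 0 ≤ p) (h1 : p ≤ 1) :
    IsDensity (isotropic d p) := by
  have hd0 : (d : ℂ) ≠ 0 := by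
    have : d ≠ 0 := by omega
    exact_mod_cast this
  constructor
  · exact ((proj_posSemidef _).smul h0).add
      ((PosSemidef.one.smul (by positivity : (0:ℝ) ≤ 1 / (d : ℝ) ^ 2)).smul (by linarith))
  · have ht : (proj (maxEnt d)).trace = 1 := by
      have : (proj fun x : Fin d × Fin d => if x.1 = x.2 then (1 : ℂ) else 0).trace = (d : ℂ) := by
        simp [proj, trace, vecMulVec_apply, Fintype.sum_prod_type]
      rw [maxEnt_eq, proj_smul, trace_smul, this, div_pow, Real.sq_sqrt (by positivity)]
      simp [hd0]
    rw [isotropic, trace_add, trace_smul, trace_smul, trace_smul, ht, trace_one]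
    simp only [Fintype.card_prod, Fintype.card_fin, Complex.real_smul]
    push_cast
    field_simp
    ring

theorem isDensity_werner {d : ℕ} (hd : 2 ≤ d) {p : ℝ} (h0 : 0 ≤ p) (h1 : p ≤ 1) :
    IsDensity (werner d p) := by
  have hd1 : (1 : ℝ) < d := by exact_mod_cast hd
  have hd0 : (d : ℂ) ≠ 0 := by
    have : d ≠ 0 := by omega
    exact_mod_cast this
  have hd2 : (d : ℂ) - 1 ≠ 0 := by
    have : (d : ℝ) - 1 ≠ 0 := by linarith
    exact_mod_cast this
  constructor
  · refine PosSemidef.add (PosSemidef.smul (PosSemidef.smul ?_ ?_) h0)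
      ((PosSemidef.one.smul (by positivity : (0:ℝ) ≤ 1 / (d : ℝ) ^ 2)).smul (by linarith))
    · rw [asymProj_eq_sum]
      exact posSemidef_sum _ fun i _ => posSemidef_sum _ fun j _ => proj_posSemidef _
    · have : 0 < (d : ℝ) - 1 := by linarith
      positivity
  · have ht : (swapOp d).trace = (d : ℂ) := by
      simp only [swapOp, trace, diag_apply, of_apply, Fintype.sum_prod_type, Prod.swap,
        Prod.mk.injEq, ite_and]
      simp
    rw [werner, trace_add, trace_smul, trace_smul, trace_smul, trace_smul, asymProj, trace_smul,
      trace_sub, ht, trace_one]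
    simp only [Fintype.card_prod, Fintype.card_fin, Complex.real_smul]
    push_cast
    field_simp
    ring

/-! ### Genuine multipartite entanglement -/

theorem sum_le_sum_of_injOn {α β : Type*} [DecidableEq β] {s : Finset α} {t : Finset β}
    {f : α → ℝ} {g : β → ℝ} (e : α → β) (he : ∀ a ∈ s, e a ∈ t) (hinj : Set.InjOn e s)
    (hg : ∀ b ∈ t, 0 ≤ g b) (hfg : ∀ a ∈ s, f a = g (e a)) : ∑ a ∈ s, f a ≤ ∑ b ∈ t, g b := by
  rw [Finset.sum_congr rfl hfg, ← Finset.sum_image hinj]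
  refine Finset.sum_le_sum_of_subset_of_nonneg (fun b hb => ?_) fun b hb _ => hg b hb
  obtain ⟨a, ha, rfl⟩ := Finset.mem_image.1 hb
  exact he a ha

/-- The configuration that agrees with `x` on the parties in `S` and with `y` elsewhere. -/
def mix {N d : ℕ} (S : Finset (Fin N)) (x y : Fin N → Fin d) : Fin N → Fin d :=
  fun n => if n ∈ S then x n else y n

/-- The vector `x ↦ a x * b x` is a pure state that factorizes across the bipartition of the
parties into `S` and its complement: `a` reads only the coordinates in `S`, `b` only the
others. -/
structure IsBiproduct {N d : ℕ} (S : Finset (Fin N)) (a b : (Fin N → Fin d) → ℂ) : Prop where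
  left : ∀ x y, a (mix S x y) = a x
  right : ∀ x y, b (mix S x y) = b y
  norm_eq_one : ∑ x, ‖a x * b x‖ ^ 2 = 1

theorem IsBiproduct.mix_apply {N d : ℕ} {S : Finset (Fin N)} {a b : (Fin N → Fin d) → ℂ}
    (h : IsBiproduct S a b) (x y : Fin N → Fin d) :
    a (mix S x y) * b (mix S x y) = a x * b y := by
  rw [h.left, h.right]

/-- A pure product state is in particular a product across the bipartition of one group against
all the others. -/
theorem exists_isBiproduct {N K d : ℕ} (c : Fin N → Fin K)
    (ψ : (k : Fin K) → ((Group c k → Fin d) → ℂ)) (hψ : ∀ k, IsPure (ψ k)) (k : Fin K) :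
    ∃ a b : (Fin N → Fin d) → ℂ, IsBiproduct {n | c n = k} a b ∧
      groupTensor c (fun k => proj (ψ k)) = proj (fun x => a x * b x) := by
  have hprod : ∀ x : Fin N → Fin d,
      (ψ k fun n => x n) * ∏ j ∈ Finset.univ.erase k, ψ j (fun n => x n) =
        ∏ j, ψ j (fun n => x n) := fun x =>
    Finset.mul_prod_erase _ (fun j => ψ j fun n => x n) (Finset.mem_univ k)
  refine ⟨fun x => ψ k fun n => x n, fun x => ∏ j ∈ Finset.univ.erase k, ψ j fun n => x n,
    ⟨fun x y => ?_, fun x y => ?_, ?_⟩, ?_⟩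
  · congr 1
    funext n
    simp [mix, n.2]
  · refine Finset.prod_congr rfl fun j hj => ?_
    congr 1
    funext n
    simp [mix, n.2, Finset.ne_of_mem_erase hj]
  · simp only [hprod, norm_prod, ← Finset.prod_pow]
    -- configurations split into their restrictions to the groups, so the norms multiply
    let e : (Fin N → Fin d) ≃ ((k : Fin K) → Group c k → Fin d) :=
      ((Equiv.sigmaFiberEquiv c).arrowCongr (Equiv.refl _)).symm.trans
        (Equiv.piCurry fun (k : Fin K) (_ : Group c k) => Fin d)
    calc ∑ x : Fin N → Fin d, ∏ j, ‖ψ j fun n => x n‖ ^ 2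
        = ∑ y : (k : Fin K) → Group c k → Fin d, ∏ j, ‖ψ j (y j)‖ ^ 2 :=
          Fintype.sum_equiv e _ _ fun x => rfl
      _ = ∏ j, ∑ z, ‖ψ j z‖ ^ 2 := (Fintype.prod_sum fun j z => ‖ψ j z‖ ^ 2).symm
      _ = 1 := Finset.prod_eq_one fun j _ => hψ j
  · ext x y
    simp only [groupTensor, of_apply, proj, vecMulVec_apply, Pi.star_apply, hprod,
      Finset.prod_mul_distrib, star_prod]

/-- An entanglement witness: a real-linear functional bounded by `r` on the pure states that are
products across some bipartition is bounded by `r` on all `K`-separable states. -/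
theorem le_of_isKSeparable {N d K : ℕ} (hK : 2 ≤ K) (F : Op (Fin N) d →ₗ[ℝ] ℝ) (r : ℝ)
    (hF : ∀ (S : Finset (Fin N)) (a b : (Fin N → Fin d) → ℂ), S.Nonempty → (∃ n, n ∉ S) →
      IsBiproduct S a b → F (proj fun x => a x * b x) ≤ r)
    {ρ : Op (Fin N) d} (hρ : IsKSeparable K ρ) : F ρ ≤ r := by
  have hconv : Convex ℝ {ρ | F ρ ≤ r} := convex_halfSpace_le F.isLinear r
  refine convexHull_min ?_ hconv hρ
  rintro σ ⟨c, hc, hσ⟩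
  refine convexHull_min ?_ hconv hσ
  rintro τ ⟨ψ, hψ, rfl⟩
  obtain ⟨a, b, hab, he⟩ := exists_isBiproduct c ψ hψ ⟨0, by omega⟩
  obtain ⟨n, hn⟩ := hc ⟨0, by omega⟩
  obtain ⟨m, hm⟩ := hc ⟨1, by omega⟩
  rw [Set.mem_ofPred_eq, he]
  exact hF _ a b ⟨n, by simp [hn]⟩ ⟨m, by simp [hm]⟩ hab

theorem extend_apply_cutPt {N L d : ℕ} (hL : 1 ≤ L) (hLN : L + 1 ≤ N)
    (ρ : Matrix (Fin d × Fin d) (Fin d × Fin d) ℂ) (i j i' j' : Fin d) :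
    extend N L ρ (cutPt N L i j) (cutPt N L i' j') = ρ (i, j) (i', j') := by
  have h : ∀ (i j : Fin d) (z : Fin d × Fin d),
      cutIso N L d (cutPt N L i j) z = if z = (i, j) then 1 else 0 := by
    intro i j z
    rw [cutIso_apply]
    congr 1
    rw [eq_iff_iff]
    constructor
    · intro hz
      have := cutPt_injective hL hLN hz
      exact Prod.ext this.1.symm this.2.symm
    · rintro rfl; rfl
  simp [extend, mul_apply, h]

theorem extend_apply_eq_zero {N L d : ℕ} (ρ : Matrix (Fin d × Fin d) (Fin d × Fin d) ℂ)
    {x : Fin N → Fin d} (hx : ∀ i j, x ≠ cutPt N L i j) (y : Fin N → Fin d) :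
    extend N L ρ x y = 0 := by
  simp [extend, mul_apply, cutIso_apply, hx]

theorem not_isKSeparable_ghzState {N L d K : ℕ} (hL : 1 ≤ L) (hLN : L + 1 ≤ N) (hd : 2 ≤ d)
    {p : ℝ} (hp : 1 / ((d : ℝ) + 1) < p) (hK : 2 ≤ K) : ¬ IsKSeparable K (ghzState N L d p) := by
  intro hsep
  -- `d` times the fidelity with the GHZ vector
  let F : Op (Fin N) d →ₗ[ℝ] ℝ :=
    { toFun := fun ρ => (∑ i : Fin d, ∑ j : Fin d, ρ (fun _ => i) (fun _ => j)).re
      map_add' := fun ρ σ => by simp [Finset.sum_add_distrib]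
      map_smul' := fun r ρ => by simp [Finset.mul_sum] }
  have hle : F (ghzState N L d p) ≤ 1 := by
    refine le_of_isKSeparable hK F 1 (fun S a b hS hS' hab => ?_) hsep
    obtain ⟨n, hn⟩ := hS
    obtain ⟨m, hm⟩ := hS'
    let A : Fin d → ℂ := fun i => a fun _ => i
    let B : Fin d → ℂ := fun i => b fun _ => i
    have hF : F (proj fun x => a x * b x) = ‖∑ i, A i * B i‖ ^ 2 := by
      have : ∑ i : Fin d, ∑ j : Fin d, (proj fun x => a x * b x) (fun _ => i) (fun _ => j) =
          (∑ i, A i * B i) * star (∑ i, A i * B i) := by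
        rw [star_sum, Finset.sum_mul_sum]
        rfl
      change (∑ i : Fin d, ∑ j : Fin d,
        (proj fun x => a x * b x) (fun _ => i) (fun _ => j)).re = _
      rw [this, RCLike.star_def, Complex.mul_conj, Complex.ofReal_re, Complex.normSq_eq_norm_sq]
    -- the configurations with one value on `S` and another off `S` carry weight at most one
    have hw : ∑ ij : Fin d × Fin d, ‖A ij.1 * B ij.2‖ ^ 2 ≤ 1 := by
      rw [← hab.norm_eq_one]
      refine sum_le_sum_of_injOn (fun ij => mix S (fun _ => ij.1) (fun _ => ij.2))
        (fun _ _ => Finset.mem_univ _) ?_ (fun _ _ => by positivity) (fun ij _ => ?_)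
      · intro ij _ kl _ h
        have h1 := congrFun h n
        have h2 := congrFun h m
        simp only [mix, hn, hm, if_true, if_false] at h1 h2
        exact Prod.ext h1 h2
      · rw [hab.mix_apply]
    rw [hF]
    calc ‖∑ i, A i * B i‖ ^ 2 ≤ (∑ i, ‖A i‖ * ‖B i‖) ^ 2 := by
          gcongr
          exact (norm_sum_le _ _).trans_eq (by simp)
      _ ≤ (∑ i, ‖A i‖ ^ 2) * ∑ i, ‖B i‖ ^ 2 := Finset.sum_mul_sq_le_sq_mul_sq _ _ _
      _ = ∑ ij : Fin d × Fin d, ‖A ij.1 * B ij.2‖ ^ 2 := by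
          simp only [Finset.sum_mul_sum, Fintype.sum_prod_type, norm_mul, mul_pow]
      _ ≤ 1 := hw
  have hval : F (ghzState N L d p) = p * d + (1 - p) / d := by
    have hc : ∀ i : Fin d, (fun _ => i : Fin N → Fin d) = cutPt N L i i := fun i => by
      funext n; simp [cutPt]
    have hm : ∀ i : Fin d, maxEnt d (i, i) = ((1 / √(d : ℝ) : ℝ) : ℂ) := fun i => by
      simp [maxEnt_eq]
    have hi : ∀ i j : Fin d, isotropic d p (i, i) (j, j) =
        ((p * (1 / d) + (1 - p) * (1 / d ^ 2) * (if i = j then 1 else 0) : ℝ) : ℂ) := by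
      intro i j
      have hs : (1 / √(d : ℝ)) * (1 / √(d : ℝ)) = 1 / d := by
        rw [div_mul_div_comm, Real.mul_self_sqrt (Nat.cast_nonneg d), one_mul]
      simp only [isotropic, Matrix.add_apply, Matrix.smul_apply, proj, vecMulVec_apply,
        Pi.star_apply, hm, one_apply, Prod.mk.injEq, and_self, Complex.real_smul,
        RCLike.star_def, Complex.conj_ofReal]
      rw [← Complex.ofReal_mul (1 / √(d : ℝ)), hs]
      split_ifs <;> push_cast <;> ring
    change (∑ i : Fin d, ∑ j : Fin d, ghzState N L d p (fun _ => i) (fun _ => j)).re = _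
    simp only [ghzState_eq_extend, hc, extend_apply_cutPt hL hLN, hi]
    rw [Complex.re_sum]
    simp only [Complex.re_sum, Complex.ofReal_re, Finset.sum_add_distrib, ← Finset.mul_sum,
      Finset.sum_const, Finset.card_univ, Fintype.card_fin, nsmul_eq_mul, Finset.sum_ite_eq,
      Finset.mem_univ, if_true, mul_one]
    have : (d : ℝ) ≠ 0 := by positivity
    field_simp
  rw [hval] at hle
  have hd1 : (2 : ℝ) ≤ d := by exact_mod_cast hd
  rw [div_lt_iff₀ (by positivity)] at hp
  have h1 : (p * d + (1 - p) / d) * d ≤ 1 * d := by gcongr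
  have h2 : (p * d + (1 - p) / d) * d = p * d ^ 2 + (1 - p) := by field_simp
  nlinarith

/-- If `S` splits one of the two sides of the cut, then exchanging the coordinates in `S` between
`i^L j^(N-L)` and `j^L i^(N-L)`, `i ≠ j`, leads out of the range of `cutIso`. So a negative
expectation of the swap in a product state is made up for by the weight outside that range. -/
theorem IsBiproduct.swap_add_nonneg_of_split {N L d : ℕ} {S : Finset (Fin N)}
    {a b : (Fin N → Fin d) → ℂ} (hab : IsBiproduct S a b) {n m : Fin N} (hn : n ∈ S) (hm : m ∉ S)
    (hnm : n.val < L ↔ m.val < L) :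
    0 ≤ (∑ i : Fin d, ∑ j : Fin d, (a (cutPt N L i j) * b (cutPt N L i j)) *
        star (a (cutPt N L j i) * b (cutPt N L j i))).re +
      ∑ x : Fin N → Fin d with ∀ i j, x ≠ cutPt N L i j, ‖a x * b x‖ ^ 2 := by
  obtain ⟨z, hzdef⟩ : ∃ z : Fin d → Fin d → Fin N → Fin d,
      ∀ i j, z i j = mix S (cutPt N L i j) (cutPt N L j i) := ⟨_, fun _ _ => rfl⟩
  let g : Fin d → Fin d → ℝ := fun i j => if i = j then 0 else ‖a (z i j) * b (z i j)‖ ^ 2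
  have hz : ∀ i j, a (z i j) * b (z i j) = a (cutPt N L i j) * b (cutPt N L j i) :=
    fun i j => by rw [hzdef, hab.mix_apply]
  have hterm : ∀ i j, -((1 / 2) * g i j + (1 / 2) * g j i) ≤
      ((a (cutPt N L i j) * b (cutPt N L i j)) *
        star (a (cutPt N L j i) * b (cutPt N L j i))).re := by
    intro i j
    by_cases hij : i = j
    · subst hij
      simp only [g, if_true]
      rw [RCLike.star_def, Complex.mul_conj, Complex.ofReal_re]
      rw [mul_zero, add_zero, neg_zero]
      exact Complex.normSq_nonneg _
    · simp only [g, hij, Ne.symm hij, if_false, hz]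
      have h1 := Complex.abs_re_le_norm ((a (cutPt N L i j) * b (cutPt N L i j)) *
        star (a (cutPt N L j i) * b (cutPt N L j i)))
      have h2 := (abs_le.1 h1).1
      simp only [norm_mul, norm_star] at h2 ⊢
      nlinarith [sq_nonneg (‖a (cutPt N L i j)‖ * ‖b (cutPt N L j i)‖ -
        ‖a (cutPt N L j i)‖ * ‖b (cutPt N L i j)‖)]
  have hsum : ∑ i, ∑ j, g i j ≤
      ∑ x : Fin N → Fin d with ∀ i j, x ≠ cutPt N L i j, ‖a x * b x‖ ^ 2 := by
    rw [← Fintype.sum_prod_type' (f := g)]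
    have : ∑ ij : Fin d × Fin d, g ij.1 ij.2 =
        ∑ ij : Fin d × Fin d with ij.1 ≠ ij.2, ‖a (z ij.1 ij.2) * b (z ij.1 ij.2)‖ ^ 2 := by
      rw [Finset.sum_filter]
      exact Finset.sum_congr rfl fun ij _ => by simp only [g, ne_eq, ite_not]
    rw [this]
    have hzn : ∀ i j, z i j n = if n.val < L then i else j := fun i j => by
      simp only [hzdef, mix, hn, if_true, cutPt]
    have hzm : ∀ i j, z i j m = if n.val < L then j else i := fun i j => by
      simp only [hzdef, mix, hm, if_false, cutPt, hnm]
    refine sum_le_sum_of_injOn (e := fun ij => z ij.1 ij.2) (fun ij hij => ?_) ?_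
      (fun x _ => sq_nonneg ‖a x * b x‖)
      (fun ij _ => Eq.refl (‖a (z ij.1 ij.2) * b (z ij.1 ij.2)‖ ^ 2))
    · simp only [Finset.mem_filter, Finset.mem_univ, true_and] at hij ⊢
      intro i' j' h
      have h1 := congrFun h n
      have h2 := congrFun h m
      rw [hzn] at h1
      rw [hzm] at h2
      simp only [cutPt, ← hnm] at h1 h2
      split_ifs at h1 h2 <;> exact hij (by rw [h1, h2])
    · intro ij _ kl _ h
      have h1 := congrFun h n
      have h2 := congrFun h m
      simp only [hzn, hzm] at h1 h2
      split_ifs at h1 h2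
      · exact Prod.ext h1 h2
      · exact Prod.ext h2 h1
  have hre : -∑ i, ∑ j, g i j ≤ (∑ i : Fin d, ∑ j : Fin d,
      (a (cutPt N L i j) * b (cutPt N L i j)) *
        star (a (cutPt N L j i) * b (cutPt N L j i))).re := by
    have : ∑ i, ∑ j, g i j = ∑ i, ∑ j, ((1 / 2) * g i j + (1 / 2) * g j i) := by
      simp only [Finset.sum_add_distrib, ← Finset.mul_sum]
      rw [Finset.sum_comm (f := fun i j => g j i)]
      ring
    rw [this, Complex.re_sum]
    simp only [Complex.re_sum, ← Finset.sum_neg_distrib]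
    exact Finset.sum_le_sum fun i _ => Finset.sum_le_sum fun j _ => hterm i j
  linarith

/-- If `S` is one of the two sides of the cut, then the swap has expectation `|⟨α, β⟩|²` in the
product state `α ⊗ β`. -/
theorem IsBiproduct.swap_nonneg_of_not_split {N L d : ℕ} {S : Finset (Fin N)}
    {a b : (Fin N → Fin d) → ℂ} (hab : IsBiproduct S a b) (hS : S.Nonempty) (hS' : ∃ n, n ∉ S)
    (hsplit : ∀ n m : Fin N, n ∈ S → m ∉ S → ¬ (n.val < L ↔ m.val < L)) :
    0 ≤ (∑ i : Fin d, ∑ j : Fin d, (a (cutPt N L i j) * b (cutPt N L i j)) *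
        star (a (cutPt N L j i) * b (cutPt N L j i))).re := by
  suffices h : ∃ A B : Fin d → ℂ, ∀ i j, a (cutPt N L i j) * b (cutPt N L i j) = A i * B j by
    obtain ⟨A, B, hAB⟩ := h
    have : ∑ i : Fin d, ∑ j : Fin d, (a (cutPt N L i j) * b (cutPt N L i j)) *
        star (a (cutPt N L j i) * b (cutPt N L j i)) =
        (∑ i, A i * star (B i)) * star (∑ i, A i * star (B i)) := by
      rw [star_sum, Finset.sum_mul_sum]
      refine Finset.sum_congr rfl fun i _ => Finset.sum_congr rfl fun j _ => ?_
      simp only [hAB, star_mul', star_star]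
      ring
    rw [this, RCLike.star_def, Complex.mul_conj, Complex.ofReal_re]
    exact Complex.normSq_nonneg _
  obtain ⟨n, hn⟩ := hS
  obtain ⟨m, hm⟩ := hS'
  by_cases hnL : n.val < L
  · have hSL : ∀ l : Fin N, l ∈ S ↔ l.val < L := by
      intro l
      have h1 := hsplit n l hn
      have h2 := hsplit n m hn hm
      have h3 := hsplit l m
      by_cases hl : l ∈ S <;> grind
    have hmix : ∀ i j i' j' : Fin d,
        mix S (cutPt N L i j) (cutPt N L i' j') = cutPt N L i j' := by
      intro i j i' j'
      funext l
      simp only [mix, hSL, cutPt]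
      split_ifs <;> rfl
    refine ⟨fun i => a (cutPt N L i i), fun j => b (cutPt N L j j), fun i j => ?_⟩
    rw [← hmix i i j j, hab.left, hab.right]
  · have hSL : ∀ l : Fin N, l ∈ S ↔ ¬ l.val < L := by
      intro l
      have h1 := hsplit n l hn
      have h2 := hsplit n m hn hm
      have h3 := hsplit l m
      by_cases hl : l ∈ S <;> grind
    have hmix : ∀ i j i' j' : Fin d,
        mix S (cutPt N L i j) (cutPt N L i' j') = cutPt N L i' j := by
      intro i j i' j'
      funext l
      simp only [mix, hSL, cutPt]
      split_ifs <;> simp_all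
    refine ⟨fun i => b (cutPt N L i i), fun j => a (cutPt N L j j), fun i j => ?_⟩
    rw [← hmix j j i i, hab.left, hab.right, mul_comm]

theorem not_isKSeparable_wernerGenState {N L d K : ℕ} (hL : 1 ≤ L) (hLN : L + 1 ≤ N) (hd : 2 ≤ d)
    {p : ℝ} (hp : 1 / ((d : ℝ) + 1) < p) (hK : 2 ≤ K) :
    ¬ IsKSeparable K (wernerGenState N L d p) := by
  intro hsep
  -- minus the sum of the swap of the two sides and the projector onto the complement of the
  -- range of `cutIso`
  let F : Op (Fin N) d →ₗ[ℝ] ℝ :=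
    { toFun := fun ρ => -((∑ i : Fin d, ∑ j : Fin d, ρ (cutPt N L i j) (cutPt N L j i)).re +
        (∑ x : Fin N → Fin d with ∀ i j, x ≠ cutPt N L i j, ρ x x).re)
      map_add' := fun ρ σ => by simp [Finset.sum_add_distrib]; ring
      map_smul' := fun r ρ => by simp [← Finset.mul_sum]; ring }
  have hle : F (wernerGenState N L d p) ≤ 0 := by
    refine le_of_isKSeparable hK F 0 (fun S a b hS hS' hab => ?_) hsep
    have hdiag : (∑ x : Fin N → Fin d with ∀ i j, x ≠ cutPt N L i j,
        (proj fun x => a x * b x) x x).re =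
        ∑ x : Fin N → Fin d with ∀ i j, x ≠ cutPt N L i j, ‖a x * b x‖ ^ 2 := by
      rw [Complex.re_sum]
      refine Finset.sum_congr rfl fun x _ => ?_
      simp only [proj, vecMulVec_apply, Pi.star_apply]
      rw [RCLike.star_def, Complex.mul_conj, Complex.ofReal_re, Complex.normSq_eq_norm_sq]
    change -(_ + _) ≤ (0 : ℝ)
    rw [neg_nonpos, hdiag]
    simp only [proj, vecMulVec_apply, Pi.star_apply]
    by_cases hsplit : ∃ n m, n ∈ S ∧ m ∉ S ∧ (n.val < L ↔ m.val < L)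
    · obtain ⟨n, m, hn, hm, hnm⟩ := hsplit
      exact hab.swap_add_nonneg_of_split hn hm hnm
    · refine add_nonneg (hab.swap_nonneg_of_not_split hS hS' ?_)
        (Finset.sum_nonneg fun _ _ => by positivity)
      exact fun n m hn hm hnm => hsplit ⟨n, m, hn, hm, hnm⟩
  have hd1 : (2 : ℝ) ≤ d := by exact_mod_cast hd
  have hval : F (wernerGenState N L d p) = p - (1 - p) / d := by
    have hi : ∀ i j : Fin d, werner d p (i, j) (j, i) =
        ((p * (1 / (d * (d - 1))) * ((if i = j then 1 else 0) - 1) +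
          (1 - p) * (1 / d ^ 2) * (if i = j then 1 else 0) : ℝ) : ℂ) := by
      intro i j
      simp only [werner, asymProj, swapOp, Matrix.add_apply, Matrix.smul_apply, Matrix.sub_apply,
        of_apply, one_apply, Prod.swap, Prod.mk.injEq, and_self, Complex.real_smul,
        eq_comm (a := j)]
      split_ifs <;> push_cast <;> ring
    have hout : (∑ x : Fin N → Fin d with ∀ i j, x ≠ cutPt N L i j,
        wernerGenState N L d p x x) = 0 := by
      refine Finset.sum_eq_zero fun x hx => ?_
      rw [wernerGenState_eq_extend]
      exact extend_apply_eq_zero _ (Finset.mem_filter.1 hx).2 _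
    change -((∑ i : Fin d, ∑ j : Fin d, wernerGenState N L d p (cutPt N L i j)
      (cutPt N L j i)).re + (∑ x : Fin N → Fin d with ∀ i j, x ≠ cutPt N L i j,
        wernerGenState N L d p x x).re) = _
    rw [hout]
    simp only [wernerGenState_eq_extend, extend_apply_cutPt hL hLN, hi]
    rw [Complex.re_sum]
    simp only [Complex.re_sum, Complex.ofReal_re, Finset.sum_add_distrib, Finset.sum_sub_distrib,
      ← Finset.mul_sum, Finset.sum_const, Finset.card_univ, Fintype.card_fin, nsmul_eq_mul,
      Finset.sum_ite_eq, Finset.mem_univ, if_true, mul_one, Complex.zero_re, add_zero]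
    have h1 : (d : ℝ) ≠ 0 := by positivity
    have h2 : (d : ℝ) - 1 ≠ 0 := by linarith
    field_simp
    ring
  rw [hval] at hle
  rw [div_lt_iff₀ (by positivity)] at hp
  have h1 : (p - (1 - p) / d) * d ≤ 0 * d := by gcongr
  have h2 : (p - (1 - p) / d) * d = p * d - (1 - p) := by field_simp
  nlinarith

/-! ### The complex Gaussian vector -/

/-- The squared Euclidean norm of a vector of `ℂ^d`. -/
noncomputable def normSq {d : ℕ} (z : Fin d → ℂ) : ℝ := ∑ i, ‖z i‖ ^ 2

theorem normSq_nonneg {d : ℕ} (z : Fin d → ℂ) : 0 ≤ normSq z :=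
  Finset.sum_nonneg fun _ _ => by positivity

theorem norm_sq_le_normSq {d : ℕ} (z : Fin d → ℂ) (i : Fin d) : ‖z i‖ ^ 2 ≤ normSq z :=
  Finset.single_le_sum (f := fun i => ‖z i‖ ^ 2) (fun _ _ => by positivity) (Finset.mem_univ i)

theorem normSq_eq_zero {d : ℕ} {z : Fin d → ℂ} : normSq z = 0 ↔ z = 0 := by
  rw [normSq, Finset.sum_eq_zero_iff_of_nonneg fun _ _ => by positivity]
  simp [funext_iff]

theorem ofReal_normSq {d : ℕ} (z : Fin d → ℂ) : (normSq z : ℂ) = star z ⬝ᵥ z := by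
  simp [normSq, dotProduct, Complex.conj_mul']

theorem normSq_mulVec {d : ℕ} {U : Matrix (Fin d) (Fin d) ℂ} (hU : Uᴴ * U = 1)
    (z : Fin d → ℂ) : normSq (U *ᵥ z) = normSq z := by
  have : (normSq (U *ᵥ z) : ℂ) = normSq z := by
    rw [ofReal_normSq, ofReal_normSq, star_mulVec, dotProduct_mulVec, vecMul_vecMul, hU,
      vecMul_one]
  exact_mod_cast this

@[fun_prop]
theorem continuous_normSq {d : ℕ} : Continuous (normSq (d := d)) := by
  unfold normSq; fun_prop

theorem integral_exp_neg_mul_normSq_complex {b : ℝ} (hb : 0 < b) :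
    ∫ z : ℂ, Real.exp (-b * ‖z‖ ^ 2) = Real.pi / b := by
  rw [GaussianFourier.integral_rexp_neg_mul_sq_norm hb]
  simp

theorem integrable_exp_neg_mul_normSq_complex {b : ℝ} (hb : 0 < b) :
    Integrable fun z : ℂ => Real.exp (-b * ‖z‖ ^ 2) := by
  by_contra h
  have := integral_exp_neg_mul_normSq_complex hb
  rw [integral_undef h] at this
  have hp : 0 < Real.pi / b := by positivity
  exact hp.ne this

theorem lintegral_gaussian_prod (d : ℕ) {b : ℝ} (hb : 0 < b) :
    ∫⁻ z : Fin d → ℂ, ENNReal.ofReal (∏ i, (Real.pi⁻¹ * Real.exp (-b * ‖z i‖ ^ 2))) =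
      ENNReal.ofReal (b⁻¹ ^ d) := by
  rw [← ofReal_integral_eq_lintegral_ofReal]
  · rw [integral_fintype_prod_volume_eq_pow (fun z : ℂ => Real.pi⁻¹ * Real.exp (-b * ‖z‖ ^ 2)),
      integral_const_mul, integral_exp_neg_mul_normSq_complex hb, Fintype.card_fin]
    congr 2
    field_simp
  · exact Integrable.fintype_prod (f := fun _ z => Real.pi⁻¹ * Real.exp (-b * ‖z‖ ^ 2))
      fun _ => (integrable_exp_neg_mul_normSq_complex hb).const_mul _
  · exact Filter.Eventually.of_forall fun z => Finset.prod_nonneg fun i _ => by positivity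

theorem lintegral_gaussian_tail {a : ℝ} (ha : 0 ≤ a) :
    ∫⁻ z in {z : ℂ | a < ‖z‖ ^ 2}, ENNReal.ofReal (Real.pi⁻¹ * Real.exp (-1 * ‖z‖ ^ 2)) =
      ENNReal.ofReal (Real.exp (-a)) := by
  have hm : MeasurableSet {z : ℂ | a < ‖z‖ ^ 2} := measurableSet_lt (by fun_prop) (by fun_prop)
  rw [← ofReal_integral_eq_lintegral_ofReal]
  rotate_left
  · exact ((integrable_exp_neg_mul_normSq_complex one_pos).const_mul _).integrableOn
  · exact Filter.Eventually.of_forall fun z => by positivity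
  congr 1
  rw [integral_const_mul, ← integral_indicator hm]
  let f : ℝ → ℝ := (Set.Ioi (√a)).indicator fun y => Real.exp (-1 * y ^ 2)
  have hf : ∀ z : ℂ, {z : ℂ | a < ‖z‖ ^ 2}.indicator (fun z => Real.exp (-1 * ‖z‖ ^ 2)) z =
      f ‖z‖ := by
    intro z
    have : √a < ‖z‖ ↔ a < ‖z‖ ^ 2 := by
      rw [← Real.sqrt_lt_sqrt_iff ha, Real.sqrt_sq (norm_nonneg z)]
    simp only [f, Set.indicator, Set.mem_Ioi, Set.mem_ofPred_eq, this]
  simp only [hf]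
  rw [integral_fun_norm_addHaar]
  have h1 : ∫ y in Set.Ioi (0 : ℝ), y ^ (Module.finrank ℝ ℂ - 1) • f y =
      ∫ y in Set.Ioi (√a), y * Real.exp (-1 * y ^ 2) := by
    have : ∀ y, y ^ (Module.finrank ℝ ℂ - 1) • f y =
        (Set.Ioi (√a)).indicator (fun y => y * Real.exp (-1 * y ^ 2)) y := by
      intro y
      simp [f, Set.indicator]
    simp only [this]
    rw [setIntegral_indicator measurableSet_Ioi, Set.Ioi_inter_Ioi,
      sup_eq_right.2 (Real.sqrt_nonneg a)]
  have h2 : ∫ y in Set.Ioi (√a), y * Real.exp (-1 * y ^ 2) = Real.exp (-a) / 2 := by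
    have hd : ∀ x ∈ Set.Ici (√a), HasDerivAt (fun y : ℝ => -(Real.exp (-1 * y ^ 2) / 2))
        (x * Real.exp (-1 * x ^ 2)) x := by
      intro x _
      exact ((((hasDerivAt_pow 2 x).const_mul (-1)).exp).div_const 2).neg.congr_deriv
        (by norm_num; ring)
    have ht : Filter.Tendsto (fun y : ℝ => -(Real.exp (-1 * y ^ 2) / 2)) Filter.atTop (nhds 0) := by
      have : Filter.Tendsto (fun y : ℝ => Real.exp (-1 * y ^ 2)) Filter.atTop (nhds 0) := by
        refine Real.tendsto_exp_atBot.comp ?_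
        simp only [neg_mul, one_mul]
        exact Filter.tendsto_neg_atTop_atBot.comp (Filter.tendsto_pow_atTop two_ne_zero)
      simpa using (this.div_const 2).neg
    rw [integral_Ioi_of_hasDerivAt_of_nonneg' hd
      (fun x hx => mul_nonneg ((Real.sqrt_nonneg a).trans hx.le) (Real.exp_nonneg _)) ht,
      Real.sq_sqrt ha]
    ring_nf
  rw [h1, h2]
  simp [Measure.real]
  field_simp

/-- The law of a vector of `d` independent standard complex Gaussians, normalized so that each
coordinate has density `exp (-‖z‖ ^ 2) / π`. -/
noncomputable def gaussian (d : ℕ) : Measure (Fin d → ℂ) :=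
  volume.withDensity fun z => ENNReal.ofReal (∏ i, (Real.pi⁻¹ * Real.exp (-1 * ‖z i‖ ^ 2)))

instance (d : ℕ) : IsProbabilityMeasure (gaussian d) := by
  constructor
  rw [gaussian, withDensity_apply _ MeasurableSet.univ, Measure.restrict_univ,
    lintegral_gaussian_prod d one_pos]
  simp

theorem gaussian_density_eq {d : ℕ} (z : Fin d → ℂ) :
    ∏ i, (Real.pi⁻¹ * Real.exp (-1 * ‖z i‖ ^ 2)) = Real.pi⁻¹ ^ d * Real.exp (-normSq z) := by
  simp [Finset.prod_mul_distrib, ← Real.exp_sum, normSq]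

/-- A unitary maps the Euclidean unit ball onto itself, so its determinant as a real linear map
has absolute value one. -/
theorem map_mulVec_volume {d : ℕ} {U : Matrix (Fin d) (Fin d) ℂ} (hU : Uᴴ * U = 1) :
    Measure.map (fun z => U *ᵥ z) (volume : Measure (Fin d → ℂ)) = volume := by
  let T : (Fin d → ℂ) →ₗ[ℝ] (Fin d → ℂ) := (Matrix.mulVecLin U).restrictScalars ℝ
  have hT : ∀ z, T z = U *ᵥ z := fun z => rfl
  let B : Set (Fin d → ℂ) := {z | normSq z ≤ 1}
  have hB : T '' B = B := by
    ext z
    constructor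
    · rintro ⟨w, hw, rfl⟩
      simpa [B, hT, normSq_mulVec hU] using hw
    · intro hz
      refine ⟨Uᴴ *ᵥ z, ?_, ?_⟩
      · have hU' : Uᴴᴴ * Uᴴ = 1 := by
          rw [conjTranspose_conjTranspose]; exact mul_eq_one_comm.1 hU
        simpa [B, normSq_mulVec hU'] using hz
      · rw [hT, mulVec_mulVec, mul_eq_one_comm.1 hU, one_mulVec]
  have hBpos : volume B ≠ 0 := by
    have ho : IsOpen {z : Fin d → ℂ | normSq z < 1} :=
      isOpen_lt continuous_normSq continuous_const
    refine (lt_of_lt_of_le (ho.measure_pos volume ⟨0, by simp [normSq]⟩)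
      (measure_mono fun z (hz : normSq z < 1) => hz.le)).ne'
  have hBfin : volume B ≠ ⊤ := by
    refine (lt_of_le_of_lt (measure_mono (t := Metric.closedBall 0 1) fun z hz => ?_)
      measure_closedBall_lt_top).ne
    rw [mem_closedBall_zero_iff, pi_norm_le_iff_of_nonneg zero_le_one]
    intro i
    have h2 : normSq z ≤ 1 := hz
    exact (sq_le_one_iff₀ (norm_nonneg _)).1 ((norm_sq_le_normSq z i).trans h2)
  have hdet : |LinearMap.det T| = 1 := by
    have h := Measure.addHaar_image_linearMap volume T B
    rw [hB] at h
    have : ENNReal.ofReal |LinearMap.det T| = 1 := by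
      rw [← ENNReal.mul_left_inj hBpos hBfin, one_mul]
      exact h.symm
    simpa using this
  have hne : LinearMap.det T ≠ 0 := by
    intro h; simp [h] at hdet
  have := Measure.map_linearMap_addHaar_eq_smul_addHaar (volume : Measure (Fin d → ℂ)) hne
  rw [abs_inv, hdet, inv_one, ENNReal.ofReal_one, one_smul] at this
  exact this

theorem map_mulVec_gaussian {d : ℕ} {U : Matrix (Fin d) (Fin d) ℂ} (hU : Uᴴ * U = 1) :
    Measure.map (fun z => U *ᵥ z) (gaussian d) = gaussian d := by
  have hm : Measurable fun z : Fin d → ℂ => U *ᵥ z :=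
    (Continuous.matrix_mulVec continuous_const continuous_id).measurable
  have hp : MeasurePreserving (fun z : Fin d → ℂ => U *ᵥ z) volume volume :=
    ⟨hm, map_mulVec_volume hU⟩
  ext s hs
  rw [Measure.map_apply hm hs, gaussian, withDensity_apply _ (hm hs), withDensity_apply _ hs,
    ← hp.setLIntegral_comp_preimage hs (by fun_prop)]
  simp only [gaussian_density_eq, normSq_mulVec hU]

/-- The share `‖z k‖ ^ 2 / ∑ i, ‖z i‖ ^ 2` of one of `n + 1` independent exponential variables in
their sum exceeds `s` with probability `(1 - s) ^ n`. -/
theorem gaussian_tail {n : ℕ} (k : Fin (n + 1)) {s : ℝ} (hs0 : 0 ≤ s) (hs1 : s < 1) :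
    gaussian (n + 1) {z | s * normSq z < ‖z k‖ ^ 2} = ENNReal.ofReal ((1 - s) ^ n) := by
  have h1s : 0 < 1 - s := by linarith
  -- conditionally on the other coordinates, `‖z k‖ ^ 2` has to exceed `r` times their sum
  let r : ℝ := s / (1 - s)
  have hr : 0 ≤ r := by positivity
  have hset : MeasurableSet {z : Fin (n + 1) → ℂ | s * normSq z < ‖z k‖ ^ 2} :=
    measurableSet_lt (by fun_prop) (by fun_prop)
  have hp := (volume_preserving_piFinSuccAbove (fun _ : Fin (n + 1) => ℂ) k).symm
  rw [gaussian, withDensity_apply _ hset, ← lintegral_indicator hset,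
    ← hp.lintegral_comp (Measurable.indicator (by fun_prop) hset)]
  have hG : ∀ w : ℂ × (Fin n → ℂ),
      {z : Fin (n + 1) → ℂ | s * normSq z < ‖z k‖ ^ 2}.indicator (fun z => ENNReal.ofReal
        (∏ i, (Real.pi⁻¹ * Real.exp (-1 * ‖z i‖ ^ 2))))
        ((MeasurableEquiv.piFinSuccAbove (fun _ : Fin (n + 1) => ℂ) k).symm w) =
      {x : ℂ | r * normSq w.2 < ‖x‖ ^ 2}.indicator (fun x => ENNReal.ofReal
        (Real.pi⁻¹ * Real.exp (-1 * ‖x‖ ^ 2))) w.1 *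
        ENNReal.ofReal (∏ i, (Real.pi⁻¹ * Real.exp (-1 * ‖w.2 i‖ ^ 2))) := by
    rintro ⟨x, y⟩
    have he : (MeasurableEquiv.piFinSuccAbove (fun _ : Fin (n + 1) => ℂ) k).symm (x, y) =
      k.insertNth x y := rfl
    have hiff : s * normSq (k.insertNth (α := fun _ => ℂ) x y) < ‖x‖ ^ 2 ↔
        r * normSq y < ‖x‖ ^ 2 := by
      have : normSq (k.insertNth (α := fun _ => ℂ) x y) = ‖x‖ ^ 2 + normSq y := by
        simp [normSq, Fin.sum_univ_succAbove _ k]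
      rw [this, show r * normSq y = s * normSq y / (1 - s) by simp only [r]; ring,
        div_lt_iff₀ h1s]
      constructor <;> intro h <;> linarith
    simp only [he, Set.indicator, Set.mem_ofPred_eq, Fin.insertNth_apply_same, hiff,
      Fin.prod_univ_succAbove _ k, Fin.insertNth_apply_succAbove]
    split_ifs
    · rw [ENNReal.ofReal_mul (by positivity)]
    · simp
  simp only [hG]
  have hmeas : Measurable fun w : ℂ × (Fin n → ℂ) =>
      {x : ℂ | r * normSq w.2 < ‖x‖ ^ 2}.indicator (fun x => ENNReal.ofReal
        (Real.pi⁻¹ * Real.exp (-1 * ‖x‖ ^ 2))) w.1 *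
        ENNReal.ofReal (∏ i, (Real.pi⁻¹ * Real.exp (-1 * ‖w.2 i‖ ^ 2))) := by
    refine Measurable.mul ?_ (by fun_prop)
    simp only [Set.indicator, Set.mem_ofPred_eq]
    exact Measurable.ite (measurableSet_lt (by fun_prop) (by fun_prop)) (by fun_prop) (by fun_prop)
  rw [Measure.volume_eq_prod, lintegral_prod_symm _ hmeas.aemeasurable]
  have hinner : ∀ y : Fin n → ℂ, ∫⁻ x : ℂ, {x : ℂ | r * normSq y < ‖x‖ ^ 2}.indicator
        (fun x => ENNReal.ofReal (Real.pi⁻¹ * Real.exp (-1 * ‖x‖ ^ 2))) x *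
        ENNReal.ofReal (∏ i, (Real.pi⁻¹ * Real.exp (-1 * ‖y i‖ ^ 2))) =
      ENNReal.ofReal (∏ i, (Real.pi⁻¹ * Real.exp (-(1 + r) * ‖y i‖ ^ 2))) := by
    intro y
    have hy : MeasurableSet {x : ℂ | r * normSq y < ‖x‖ ^ 2} :=
      measurableSet_lt (by fun_prop) (by fun_prop)
    rw [lintegral_mul_const _ (Measurable.indicator (by fun_prop) hy), lintegral_indicator hy,
      lintegral_gaussian_tail (mul_nonneg hr (normSq_nonneg y)),
      ← ENNReal.ofReal_mul (Real.exp_nonneg _), normSq, Finset.mul_sum,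
      ← Finset.sum_neg_distrib, Real.exp_sum, ← Finset.prod_mul_distrib]
    congr 1
    refine Finset.prod_congr rfl fun i _ => ?_
    rw [show -(1 + r) * ‖y i‖ ^ 2 = -(r * ‖y i‖ ^ 2) + -1 * ‖y i‖ ^ 2 by ring, Real.exp_add]
    ring
  simp only [hinner]
  rw [lintegral_gaussian_prod n (by positivity)]
  congr 2
  simp only [r]
  field_simp
  ring

/-! ### The uniformly random unit vector -/

/-- The direction of a vector of `ℂ^d`, with the junk value `0` at `0`. -/
noncomputable def direction {d : ℕ} (z : Fin d → ℂ) : Fin d → ℂ :=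
  (((√(normSq z))⁻¹ : ℝ) : ℂ) • z

theorem norm_direction_sq {d : ℕ} (z : Fin d → ℂ) (k : Fin d) :
    ‖direction z k‖ ^ 2 = ‖z k‖ ^ 2 / normSq z := by
  rw [direction, Pi.smul_apply, smul_eq_mul, norm_mul, mul_pow, Complex.norm_real, norm_inv,
    inv_pow, Real.norm_eq_abs, sq_abs, Real.sq_sqrt (normSq_nonneg z), inv_mul_eq_div]

theorem normSq_direction {d : ℕ} {z : Fin d → ℂ} (hz : z ≠ 0) : normSq (direction z) = 1 := by
  rw [normSq]
  simp only [norm_direction_sq]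
  rw [← Finset.sum_div]
  exact div_self (normSq_eq_zero.not.2 hz)

theorem direction_mulVec {d : ℕ} {U : Matrix (Fin d) (Fin d) ℂ} (hU : Uᴴ * U = 1)
    (z : Fin d → ℂ) : direction (U *ᵥ z) = U *ᵥ direction z := by
  rw [direction, direction, normSq_mulVec hU, mulVec_smul]

theorem measurable_direction {d : ℕ} : Measurable (direction (d := d)) := by
  unfold direction
  fun_prop

/-- The law of a uniformly random unit vector of `ℂ^d`. -/
noncomputable def haarVec (d : ℕ) : Measure (Fin d → ℂ) := (gaussian d).map direction

instance (d : ℕ) : IsProbabilityMeasure (haarVec d) :=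
  Measure.isProbabilityMeasure_map measurable_direction.aemeasurable

theorem ae_normSq_haarVec {d : ℕ} (hd : d ≠ 0) : ∀ᵐ z ∂haarVec d, normSq z = 1 := by
  rw [haarVec, ae_map_iff measurable_direction.aemeasurable
    (measurableSet_eq_fun (by fun_prop) (by fun_prop))]
  have : NeZero d := ⟨hd⟩
  have h0 : ∀ᵐ z : Fin d → ℂ, z ≠ 0 := by simp [ae_iff]
  filter_upwards [(withDensity_absolutelyContinuous _ _).ae_le h0] with z hz
  exact normSq_direction hz

theorem map_mulVec_haarVec {d : ℕ} {U : Matrix (Fin d) (Fin d) ℂ} (hU : Uᴴ * U = 1) :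
    MeasurePreserving (fun z => U *ᵥ z) (haarVec d) (haarVec d) := by
  have hm : Measurable fun z : Fin d → ℂ => U *ᵥ z :=
    (Continuous.matrix_mulVec continuous_const continuous_id).measurable
  refine ⟨hm, ?_⟩
  rw [haarVec, Measure.map_map hm measurable_direction]
  have : (fun z => U *ᵥ z) ∘ direction = direction ∘ fun z : Fin d → ℂ => U *ᵥ z := by
    funext z
    exact (direction_mulVec hU z).symm
  rw [this, ← Measure.map_map measurable_direction hm, map_mulVec_gaussian hU]

theorem haarVec_tail {n : ℕ} (k : Fin (n + 1)) {s : ℝ} (hs0 : 0 ≤ s) (hs1 : s < 1) :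
    haarVec (n + 1) {z | s < ‖z k‖ ^ 2} = ENNReal.ofReal ((1 - s) ^ n) := by
  rw [haarVec, Measure.map_apply measurable_direction
    (measurableSet_lt (by fun_prop) (by fun_prop)), ← gaussian_tail k hs0 hs1]
  congr 1
  ext z
  simp only [Set.mem_preimage, Set.mem_ofPred_eq, norm_direction_sq]
  by_cases hz : z = 0
  · simp [hz, normSq, hs0]
  · exact lt_div_iff₀ (lt_of_le_of_ne (normSq_nonneg z) (Ne.symm (normSq_eq_zero.not.2 hz)))

/-- The mean of `(d t - 1) t` over the event `t > 1 / d`, where `t = ‖z k‖ ^ 2` for a random unit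
vector `z`. It is computed from the tail of `t` by the layer-cake formula, which has no boundary
term because `(d t - 1) t` vanishes at the threshold `t = 1 / d`. -/
theorem integral_threshold {d : ℕ} (hd : 1 ≤ d) (k : Fin d) :
    ∫ z, (if 1 / (d : ℝ) < ‖z k‖ ^ 2 then (d * ‖z k‖ ^ 2 - 1) * ‖z k‖ ^ 2 else 0) ∂haarVec d =
      (((d : ℝ) - 1) / d) ^ d * (3 * d - 1) / (d * (d + 1)) := by
  obtain ⟨n, rfl⟩ : ∃ n, d = n + 1 := ⟨d - 1, by omega⟩
  set c : ℝ := 1 / ((n + 1 : ℕ) : ℝ) with hc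
  set D : ℝ := ((n + 1 : ℕ) : ℝ) with hD
  have hDn : D = n + 1 := by simp [hD]
  have hD0 : 0 < D := by rw [hD]; positivity
  have hc0 : 0 < c := by positivity
  have hDc : D * c = 1 := by rw [hc]; field_simp
  have hc1 : c ≤ 1 := by
    rw [hc, div_le_one hD0, hDn]; linarith [(Nat.cast_nonneg n : (0 : ℝ) ≤ n)]
  let g : ℝ → ℝ := (Set.Ioi c).indicator fun t => 2 * D * t - 1
  have hgi : ∀ a b, IntervalIntegrable g volume a b := fun a b =>
    have h : IntervalIntegrable (fun t : ℝ => 2 * D * t - 1) volume a b :=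
      Continuous.intervalIntegrable (by fun_prop) a b
    ⟨h.1.indicator measurableSet_Ioi, h.2.indicator measurableSet_Ioi⟩
  have hgn : ∀ t, 0 ≤ g t := by
    intro t
    refine Set.indicator_nonneg (fun t ht => ?_) t
    have : D * c ≤ D * t := mul_le_mul_of_nonneg_left (le_of_lt ht) hD0.le
    linarith
  have hg0 : ∀ x ≤ c, 0 ≤ x → ∫ t in (0 : ℝ)..x, g t = 0 := by
    intro x hx hx0
    rw [intervalIntegral.integral_congr (g := fun _ => (0 : ℝ)), intervalIntegral.integral_zero]
    intro t ht
    rw [Set.uIcc_of_le hx0] at ht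
    exact Set.indicator_of_notMem (fun h => absurd (ht.2.trans hx) (not_le.2 h)) _
  have hG : ∀ x, 0 ≤ x → ∫ t in (0 : ℝ)..x, g t = if c < x then (D * x - 1) * x else 0 := by
    intro x hx
    split_ifs with hcx
    · rw [← intervalIntegral.integral_add_adjacent_intervals (hgi 0 c) (hgi c x),
        hg0 c le_rfl hc0.le, zero_add]
      have : ∫ t in c..x, g t = ∫ t in c..x, (2 * D * t - 1) := by
        refine intervalIntegral.integral_congr_ae (Filter.Eventually.of_forall fun t ht => ?_)
        rw [Set.uIoc_of_le hcx.le] at ht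
        exact Set.indicator_of_mem ht.1 _
      rw [this, intervalIntegral.integral_eq_sub_of_hasDerivAt
        (f := fun t => (D * t - 1) * t) (fun t _ => ?_)
        (Continuous.intervalIntegrable (by fun_prop) _ _)]
      · rw [hDc]; ring
      · exact ((((hasDerivAt_id t).const_mul D).sub_const 1).mul (hasDerivAt_id t)).congr_deriv
          (by simp only [id]; ring)
    · exact hg0 x (not_lt.1 hcx) hx
  have htail1 : ∀ t : ℝ, 1 ≤ t → haarVec (n + 1) {z | t < ‖z k‖ ^ 2} = 0 := by
    intro t ht
    have h0 := ae_normSq_haarVec (d := n + 1) (by omega)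
    rw [ae_iff] at h0
    refine measure_mono_null ?_ h0
    intro z hz (h : normSq z = 1)
    have h1 := norm_sq_le_normSq z k
    have h2 : t < ‖z k‖ ^ 2 := hz
    linarith
  have hlc := lintegral_comp_eq_lintegral_meas_lt_mul (haarVec (n + 1))
    (f := fun z => ‖z k‖ ^ 2) (g := g) (Filter.Eventually.of_forall fun z => by positivity)
    (by fun_prop : Measurable fun z : Fin (n + 1) → ℂ => ‖z k‖ ^ 2).aemeasurable
    (fun t _ => hgi 0 t) (Filter.Eventually.of_forall hgn)
  have hr : ∀ t ∈ Set.Ioi (0 : ℝ),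
      haarVec (n + 1) {z | t < ‖z k‖ ^ 2} * ENNReal.ofReal (g t) =
        (Set.Ioc c 1).indicator (fun t => ENNReal.ofReal ((1 - t) ^ n * (2 * D * t - 1))) t := by
    intro t ht
    by_cases ht1 : 1 ≤ t
    · rw [htail1 t ht1, zero_mul]
      rcases ht1.eq_or_lt with rfl | h
      · by_cases hn : n = 0
        · subst hn
          rw [Set.indicator_of_notMem]
          simp [hc, hD]
        · simp [Set.indicator, hn]
      · rw [Set.indicator_of_notMem]
        exact fun h' => absurd h'.2 (not_le.2 h)
    · rw [haarVec_tail k (le_of_lt ht) (not_le.1 ht1)]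
      by_cases htc : c < t
      · rw [Set.indicator_of_mem (Set.mem_Ioc.2 ⟨htc, (not_le.1 ht1).le⟩), ENNReal.ofReal_mul
          (pow_nonneg (by linarith [not_le.1 ht1]) _)]
        simp only [g, Set.indicator_of_mem (Set.mem_Ioi.2 htc)]
      · rw [Set.indicator_of_notMem (fun h => htc h.1)]
        simp only [g, Set.indicator_of_notMem (fun h => htc (Set.mem_Ioi.1 h)), ENNReal.ofReal_zero,
          mul_zero]
  have hsub : Set.Ioc c 1 ∩ Set.Ioi 0 = Set.Ioc c 1 :=
    Set.inter_eq_left.2 fun t ht => Set.mem_Ioi.2 (hc0.trans ht.1)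
  rw [setLIntegral_congr_fun measurableSet_Ioi hr, setLIntegral_indicator measurableSet_Ioc,
    hsub] at hlc
  have hval : ∫ t in Set.Ioc c 1, (1 - t) ^ n * (2 * D * t - 1) =
      ((D - 1) / D) ^ (n + 1) * (3 * D - 1) / (D * (D + 1)) := by
    rw [← intervalIntegral.integral_of_le hc1, intervalIntegral.integral_eq_sub_of_hasDerivAt
      (f := fun t => -((2 * D - 1) / D * (1 - t) ^ (n + 1) - 2 * D / (D + 1) * (1 - t) ^ (n + 2)))
      (fun t _ => ?_) (Continuous.intervalIntegrable (by fun_prop) _ _)]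
    · have hq : 1 - c = (D - 1) / D := by rw [hc]; field_simp
      simp only [sub_self, hq, pow_succ]
      field_simp
      ring
    · have h1 : HasDerivAt (fun t : ℝ => 1 - t) (-1) t := by
        simpa using (hasDerivAt_id t).const_sub 1
      refine (((h1.pow (n + 1)).const_mul ((2 * D - 1) / D)).sub
        ((h1.pow (n + 2)).const_mul (2 * D / (D + 1)))).neg.congr_deriv ?_
      have h2 : (n : ℝ) + 1 + 1 ≠ 0 := by positivity
      have h3 : (n : ℝ) + 1 ≠ 0 := by positivity
      simp only [hDn]
      push_cast
      simp only [pow_succ]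
      field_simp
      ring
  rw [integral_eq_lintegral_of_nonneg_ae]
  rotate_left
  · refine Filter.Eventually.of_forall fun z => ?_
    dsimp only
    rw [← hG _ (by positivity)]
    exact intervalIntegral.integral_nonneg (by positivity) fun t _ => hgn t
  · exact (Measurable.ite (measurableSet_lt (by fun_prop) (by fun_prop)) (by fun_prop)
      (by fun_prop)).aestronglyMeasurable
  have hl : ∀ z : Fin (n + 1) → ℂ, (if c < ‖z k‖ ^ 2 then (D * ‖z k‖ ^ 2 - 1) * ‖z k‖ ^ 2 else 0) =
      ∫ t in (0 : ℝ)..‖z k‖ ^ 2, g t := fun z => (hG _ (by positivity)).symm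
  simp only [hl]
  rw [hlc, ← hval, integral_eq_lintegral_of_nonneg_ae]
  · refine (ae_restrict_iff' measurableSet_Ioc).2 (Filter.Eventually.of_forall fun t ht => ?_)
    have : D * c ≤ D * t := mul_le_mul_of_nonneg_left (le_of_lt ht.1) hD0.le
    exact mul_nonneg (pow_nonneg (by linarith [ht.2]) _) (by linarith)
  · fun_prop

/-! ### Second moments of the random unit vector -/

/-- The expectation `⟨z|F|z⟩` (its real part, if `F` is not Hermitian). -/
noncomputable def quad {d : ℕ} (F : Matrix (Fin d) (Fin d) ℂ) (z : Fin d → ℂ) : ℝ :=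
  (star z ⬝ᵥ (F *ᵥ z)).re

@[fun_prop]
theorem continuous_quad {d : ℕ} (F : Matrix (Fin d) (Fin d) ℂ) : Continuous (quad F) := by
  unfold quad dotProduct mulVec dotProduct
  fun_prop

theorem quad_eq_sum {d : ℕ} (F : Matrix (Fin d) (Fin d) ℂ) (z : Fin d → ℂ) :
    quad F z = ∑ i, ∑ j, (star (z i) * (F i j * z j)).re := by
  simp only [quad, dotProduct, mulVec, Pi.star_apply, Complex.re_sum, Finset.mul_sum]

theorem quad_one {d : ℕ} {z : Fin d → ℂ} (hz : normSq z = 1) : quad 1 z = 1 := by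
  rw [quad, one_mulVec, ← ofReal_normSq, Complex.ofReal_re, hz]

theorem quad_sum {d : ℕ} {O : Type*} [Fintype O] (F : O → Matrix (Fin d) (Fin d) ℂ)
    (z : Fin d → ℂ) : quad (∑ a, F a) z = ∑ a, quad (F a) z := by
  simp only [quad, sum_mulVec, dotProduct_sum, Complex.re_sum]

theorem quad_nonneg {d : ℕ} {F : Matrix (Fin d) (Fin d) ℂ} (hF : F.PosSemidef)
    (z : Fin d → ℂ) : 0 ≤ quad F z :=
  (Complex.le_def.1 (hF.dotProduct_mulVec_nonneg z)).1

theorem quad_mulVec {d : ℕ} (F U : Matrix (Fin d) (Fin d) ℂ) (z : Fin d → ℂ) :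
    quad F (U *ᵥ z) = quad (Uᴴ * F * U) z := by
  rw [quad, quad, star_mulVec, ← dotProduct_mulVec, mulVec_mulVec, mulVec_mulVec]

theorem integrable_haarVec {d : ℕ} (hd : d ≠ 0) {f : (Fin d → ℂ) → ℝ} (hf : Measurable f)
    (C : ℝ) (hC : ∀ z, normSq z = 1 → |f z| ≤ C) : Integrable f (haarVec d) :=
  Integrable.of_bound hf.aestronglyMeasurable C <| by
    filter_upwards [ae_normSq_haarVec hd] with z hz
    exact hC z hz

theorem norm_le_one_of_normSq {d : ℕ} {z : Fin d → ℂ} (hz : normSq z = 1) (i : Fin d) :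
    ‖z i‖ ≤ 1 := by
  have := norm_sq_le_normSq z i
  rw [hz] at this
  exact (sq_le_one_iff₀ (norm_nonneg _)).1 this

theorem abs_quad_le {d : ℕ} (F : Matrix (Fin d) (Fin d) ℂ) {z : Fin d → ℂ} (hz : normSq z = 1) :
    |quad F z| ≤ ∑ i, ∑ j, ‖F i j‖ := by
  rw [quad_eq_sum]
  refine (Finset.abs_sum_le_sum_abs _ _).trans (Finset.sum_le_sum fun i _ => ?_)
  refine (Finset.abs_sum_le_sum_abs _ _).trans (Finset.sum_le_sum fun j _ => ?_)
  refine (Complex.abs_re_le_norm _).trans ?_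
  rw [norm_mul, norm_mul, norm_star]
  have h1 := norm_le_one_of_normSq hz i
  have h2 := norm_le_one_of_normSq hz j
  calc ‖z i‖ * (‖F i j‖ * ‖z j‖) ≤ 1 * (‖F i j‖ * 1) := by gcongr
    _ = ‖F i j‖ := by ring

theorem integral_comp_mulVec_haarVec {d : ℕ} {U : Matrix (Fin d) (Fin d) ℂ} (hU : Uᴴ * U = 1)
    {f : (Fin d → ℂ) → ℝ} (hf : Measurable f) :
    ∫ z, f (U *ᵥ z) ∂haarVec d = ∫ z, f z ∂haarVec d := by
  have h := map_mulVec_haarVec hU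
  rw [← h.map_eq, integral_map h.measurable.aemeasurable hf.aestronglyMeasurable, h.map_eq]

theorem integral_comp_perm_haarVec {d : ℕ} (σ : Equiv.Perm (Fin d))
    {f : (Fin d → ℂ) → ℝ} (hf : Measurable f) :
    ∫ z, f (z ∘ σ) ∂haarVec d = ∫ z, f z ∂haarVec d := by
  have hU : (σ.permMatrix ℂ)ᴴ * σ.permMatrix ℂ = 1 := by
    rw [conjTranspose_permMatrix, ← permMatrix_mul]
    simp
  rw [← integral_comp_mulVec_haarVec hU hf]
  simp only [permMatrix_mulVec]

theorem integral_offDiag_haarVec {d : ℕ} {φ : ℝ → ℝ} (hφ : Measurable φ) (k : Fin d) {i j : Fin d}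
    (hij : i ≠ j) (c : ℂ) :
    ∫ z, φ (‖z k‖ ^ 2) * (star (z i) * (c * z j)).re ∂haarVec d = 0 := by
  -- flipping the sign of the coordinate `i` flips the sign of the integrand
  let U : Matrix (Fin d) (Fin d) ℂ := diagonal fun l => if l = i then -1 else 1
  have hU : Uᴴ * U = 1 := by
    simp only [U, diagonal_conjTranspose, diagonal_mul_diagonal]
    rw [← diagonal_one]
    congr 1
    funext l
    by_cases hl : l = i <;> simp [hl]
  have hUz : ∀ (z : Fin d → ℂ) l, (U *ᵥ z) l = (if l = i then -1 else 1) * z l := fun z l =>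
    mulVec_diagonal _ _ _
  have h := integral_comp_mulVec_haarVec hU
    (f := fun z => φ (‖z k‖ ^ 2) * (star (z i) * (c * z j)).re) (by fun_prop)
  have h2 : ∀ z : Fin d → ℂ, φ (‖(U *ᵥ z) k‖ ^ 2) *
      (star ((U *ᵥ z) i) * (c * (U *ᵥ z) j)).re =
      -(φ (‖z k‖ ^ 2) * (star (z i) * (c * z j)).re) := by
    intro z
    have hk : ‖(U *ᵥ z) k‖ = ‖z k‖ := by
      rw [hUz]; split_ifs <;> simp
    rw [hk, hUz, hUz]
    simp [hij.symm]
    ring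
  simp only [h2, integral_neg] at h
  linarith

/-- Invariance under permutations and sign changes of the coordinates leaves only two independent
second moments of the random unit vector `z` weighted by a function of `‖z k‖ ^ 2`. -/
theorem integral_weight_mul_quad {d : ℕ} (hd : 2 ≤ d) {φ : ℝ → ℝ} (hφ : Measurable φ) {C : ℝ}
    (hC : ∀ t, 0 ≤ t → t ≤ 1 → |φ t| ≤ C) (k : Fin d) (F : Matrix (Fin d) (Fin d) ℂ) :
    ∫ z, φ (‖z k‖ ^ 2) * quad F z ∂haarVec d =
      (∫ z, φ (‖z k‖ ^ 2) * (d * ‖z k‖ ^ 2 - 1) ∂haarVec d) / (d - 1) * (F k k).re +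
      (∫ z, φ (‖z k‖ ^ 2) * (1 - ‖z k‖ ^ 2) ∂haarVec d) / (d - 1) * F.trace.re := by
  have hd0 : d ≠ 0 := by omega
  have hd1 : (d : ℝ) - 1 ≠ 0 := by
    have : (2 : ℝ) ≤ d := by exact_mod_cast hd
    linarith
  have hb : ∀ z : Fin d → ℂ, normSq z = 1 → |φ (‖z k‖ ^ 2)| ≤ C := fun z hz =>
    hC _ (by positivity) (hz ▸ norm_sq_le_normSq z k)
  have hint : ∀ {f : (Fin d → ℂ) → ℝ}, Measurable f → ∀ B, (∀ z, normSq z = 1 → |f z| ≤ B) →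
      Integrable (fun z => φ (‖z k‖ ^ 2) * f z) (haarVec d) := by
    intro f hf B hB
    refine integrable_haarVec hd0 (by fun_prop) (C * B) fun z hz => ?_
    rw [abs_mul]
    exact mul_le_mul (hb z hz) (hB z hz) (abs_nonneg _) ((abs_nonneg _).trans (hb z hz))
  have hsq : ∀ (i : Fin d) (z : Fin d → ℂ), normSq z = 1 → |‖z i‖ ^ 2| ≤ 1 := fun i z hz => by
    rw [abs_of_nonneg (by positivity)]
    exact hz ▸ norm_sq_le_normSq z i
  let I : Fin d → ℝ := fun i => ∫ z, φ (‖z k‖ ^ 2) * ‖z i‖ ^ 2 ∂haarVec d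
  let m : ℝ := ∫ z, φ (‖z k‖ ^ 2) ∂haarVec d
  have hI : ∀ i, i ≠ k → ∀ j, j ≠ k → I i = I j := by
    intro i hi j hj
    have := integral_comp_perm_haarVec (Equiv.swap i j)
      (f := fun z : Fin d → ℂ => φ (‖z k‖ ^ 2) * ‖z j‖ ^ 2) (by fun_prop)
    simpa [I, Equiv.swap_apply_of_ne_of_ne hi.symm hj.symm] using this
  have hsum : ∑ i, I i = m := by
    simp only [I, m]
    rw [← integral_finsetSum _ fun i _ => hint (by fun_prop) 1 (hsq i)]
    refine integral_congr_ae ?_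
    filter_upwards [ae_normSq_haarVec hd0] with z hz
    rw [← Finset.mul_sum]
    change φ _ * normSq z = _
    rw [hz, mul_one]
  have hw : ∀ i, i ≠ k → I i = (m - I k) / (d - 1) := by
    intro i hi
    rw [← hsum, ← Finset.add_sum_erase _ _ (Finset.mem_univ k), Finset.sum_congr rfl
      (fun j hj => hI j (Finset.ne_of_mem_erase hj) i hi), Finset.sum_const,
      Finset.card_erase_of_mem (Finset.mem_univ k), Finset.card_univ, Fintype.card_fin,
      nsmul_eq_mul, Nat.cast_sub (by omega)]
    push_cast
    field_simp
    ring
  have hmean1 : ∫ z, φ (‖z k‖ ^ 2) * (d * ‖z k‖ ^ 2 - 1) ∂haarVec d = d * I k - m := by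
    simp only [I, m]
    rw [← integral_const_mul, ← integral_sub]
    · refine integral_congr_ae (Filter.Eventually.of_forall fun z => ?_)
      dsimp only
      ring
    · exact (hint (by fun_prop) 1 (hsq k)).const_mul _
    · exact integrable_haarVec hd0 (by fun_prop) C hb
  have hmean2 : ∫ z, φ (‖z k‖ ^ 2) * (1 - ‖z k‖ ^ 2) ∂haarVec d = m - I k := by
    simp only [I, m]
    rw [← integral_sub]
    · refine integral_congr_ae (Filter.Eventually.of_forall fun z => ?_)
      dsimp only
      ring
    · exact integrable_haarVec hd0 (by fun_prop) C hb
    · exact hint (by fun_prop) 1 (hsq k)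
  have hterm : ∀ i j, Integrable (fun z => φ (‖z k‖ ^ 2) * (star (z i) * (F i j * z j)).re)
      (haarVec d) := by
    intro i j
    refine hint (by fun_prop) ‖F i j‖ fun z hz => (Complex.abs_re_le_norm _).trans ?_
    rw [norm_mul, norm_mul, norm_star]
    have h1 := norm_le_one_of_normSq hz i
    have h2 := norm_le_one_of_normSq hz j
    calc ‖z i‖ * (‖F i j‖ * ‖z j‖) ≤ 1 * (‖F i j‖ * 1) := by gcongr
      _ = ‖F i j‖ := by ring
  have hdiag : ∀ i, ∫ z, φ (‖z k‖ ^ 2) * (star (z i) * (F i i * z i)).re ∂haarVec d =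
      (F i i).re * I i := by
    intro i
    simp only [I]
    rw [← integral_const_mul]
    refine integral_congr_ae (Filter.Eventually.of_forall fun z => ?_)
    have : star (z i) * (F i i * z i) = F i i * ((‖z i‖ ^ 2 : ℝ) : ℂ) := by
      rw [Complex.ofReal_pow, ← Complex.conj_mul', RCLike.star_def]; ring
    dsimp only
    rw [this, Complex.re_mul_ofReal]
    ring
  have hmain : ∫ z, φ (‖z k‖ ^ 2) * quad F z ∂haarVec d = ∑ i, (F i i).re * I i := by
    simp only [quad_eq_sum, Finset.mul_sum]
    rw [integral_finsetSum _ fun i _ => integrable_finsetSum _ fun j _ => hterm i j]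
    refine Finset.sum_congr rfl fun i _ => ?_
    rw [integral_finsetSum _ fun j _ => hterm i j, Finset.sum_eq_single i, hdiag]
    · intro j _ hj
      exact integral_offDiag_haarVec hφ k hj.symm _
    · simp
  rw [hmain, hmean1, hmean2, trace, Complex.re_sum, ← Finset.add_sum_erase _ _ (Finset.mem_univ k),
    ← Finset.add_sum_erase (Finset.univ) (fun i => (F.diag i).re) (Finset.mem_univ k),
    Finset.sum_congr rfl (fun i hi => by rw [hw i (Finset.ne_of_mem_erase hi)]),
    ← Finset.sum_mul]
  simp only [diag_apply]
  field_simp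
  ring

theorem integral_quad {d : ℕ} (hd : 2 ≤ d) (F : Matrix (Fin d) (Fin d) ℂ) :
    ∫ z, quad F z ∂haarVec d = F.trace.re / d := by
  have hd0 : d ≠ 0 := by omega
  have hd' : (d : ℝ) ≠ 0 := by exact_mod_cast hd0
  have hd1 : (d : ℝ) - 1 ≠ 0 := by
    have : (2 : ℝ) ≤ d := by exact_mod_cast hd
    linarith
  let k : Fin d := ⟨0, by omega⟩
  have hi : ∀ i : Fin d, Integrable (fun z : Fin d → ℂ => ‖z i‖ ^ 2) (haarVec d) := fun i =>
    integrable_haarVec hd0 (by fun_prop) 1 fun z hz => by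
      rw [abs_of_nonneg (by positivity)]
      exact hz ▸ norm_sq_le_normSq z i
  have hk : ∫ z : Fin d → ℂ, ‖z k‖ ^ 2 ∂haarVec d = 1 / d := by
    have h1 : ∀ i : Fin d, ∫ z : Fin d → ℂ, ‖z i‖ ^ 2 ∂haarVec d =
        ∫ z : Fin d → ℂ, ‖z k‖ ^ 2 ∂haarVec d := by
      intro i
      have := integral_comp_perm_haarVec (Equiv.swap i k)
        (f := fun z : Fin d → ℂ => ‖z k‖ ^ 2) (by fun_prop)
      simpa using this
    have h2 : ∑ i : Fin d, ∫ z : Fin d → ℂ, ‖z i‖ ^ 2 ∂haarVec d = 1 := by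
      rw [← integral_finsetSum _ fun i _ => hi i]
      have : ∫ z : Fin d → ℂ, ∑ i, ‖z i‖ ^ 2 ∂haarVec d = ∫ _, (1 : ℝ) ∂haarVec d := by
        refine integral_congr_ae ?_
        filter_upwards [ae_normSq_haarVec hd0] with z hz
        exact hz
      rw [this]
      simp
    simp only [h1, Finset.sum_const, Finset.card_univ, Fintype.card_fin, nsmul_eq_mul] at h2
    field_simp
    linarith
  have h := integral_weight_mul_quad hd (φ := fun _ => 1) measurable_const (C := 1)
    (fun _ _ _ => by simp) k F
  simp only [one_mul] at h
  rw [h, integral_sub ((hi k).const_mul _) (integrable_const _),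
    integral_sub (integrable_const _) (hi k), integral_const_mul, hk]
  simp
  field_simp
  ring

/-! ### The local model for two qudits -/

/-- The response of a rank-one effect: the overlap `t` of the effect with the hidden vector, cut
off at the threshold `1 / d`. -/
noncomputable def threshold (d : ℕ) (t : ℝ) : ℝ := if 1 / (d : ℝ) < t then t else 0

@[fun_prop]
theorem measurable_threshold {d : ℕ} : Measurable (threshold d) :=
  Measurable.ite measurableSet_Ioi measurable_id measurable_const

theorem threshold_nonneg {d : ℕ} (t : ℝ) : 0 ≤ threshold d t := by
  unfold threshold
  split_ifs with h
  · exact le_trans (by positivity) h.le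
  · exact le_rfl

theorem threshold_le {d : ℕ} {t : ℝ} (ht : 0 ≤ t) : threshold d t ≤ t := by
  unfold threshold
  split_ifs
  · exact le_rfl
  · exact ht

/-- The response `∑ k, e k * threshold (‖⟨v k|z⟩‖ ^ 2)` of an effect with spectral decomposition
`E = ∑ k, e k |v k⟩⟨v k|`, which amounts to measuring the rank-one effects `e k |v k⟩⟨v k|`. -/
noncomputable def answer {d : ℕ} {E : Matrix (Fin d) (Fin d) ℂ} (hE : E.IsHermitian)
    (z : Fin d → ℂ) : ℝ :=
  ∑ k, hE.eigenvalues k *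
    threshold d (‖((hE.eigenvectorUnitary : Matrix (Fin d) (Fin d) ℂ)ᴴ *ᵥ z) k‖ ^ 2)

theorem conjTranspose_mul_eigenvectorUnitary {d : ℕ} {E : Matrix (Fin d) (Fin d) ℂ}
    (hE : E.IsHermitian) : (hE.eigenvectorUnitary : Matrix (Fin d) (Fin d) ℂ)ᴴ *
      (hE.eigenvectorUnitary : Matrix (Fin d) (Fin d) ℂ) = 1 :=
  (Unitary.mem_iff.1 hE.eigenvectorUnitary.2).1

theorem eq_mul_diagonal_eigenvalues_mul {d : ℕ} {E : Matrix (Fin d) (Fin d) ℂ}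
    (hE : E.IsHermitian) : E = (hE.eigenvectorUnitary : Matrix (Fin d) (Fin d) ℂ) *
      diagonal (fun k => (hE.eigenvalues k : ℂ)) *
      (hE.eigenvectorUnitary : Matrix (Fin d) (Fin d) ℂ)ᴴ := by
  conv_lhs => rw [hE.spectral_theorem, Unitary.conjStarAlgAut_apply]
  rfl

theorem trace_mul_eq_sum_eigenvalues {d : ℕ} {E : Matrix (Fin d) (Fin d) ℂ}
    (hE : E.IsHermitian) (F : Matrix (Fin d) (Fin d) ℂ) :
    (E * F).trace.re = ∑ k, hE.eigenvalues k *
      (((hE.eigenvectorUnitary : Matrix (Fin d) (Fin d) ℂ)ᴴ * F *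
        (hE.eigenvectorUnitary : Matrix (Fin d) (Fin d) ℂ)) k k).re := by
  set U := (hE.eigenvectorUnitary : Matrix (Fin d) (Fin d) ℂ) with hU
  conv_lhs => rw [eq_mul_diagonal_eigenvalues_mul hE, ← hU]
  rw [Matrix.mul_assoc, Matrix.mul_assoc, trace_mul_comm, Matrix.mul_assoc, trace, Complex.re_sum]
  refine Finset.sum_congr rfl fun k _ => ?_
  rw [diag_apply, diagonal_mul, Complex.re_ofReal_mul]

theorem quad_eq_sum_eigenvalues {d : ℕ} {E : Matrix (Fin d) (Fin d) ℂ} (hE : E.IsHermitian)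
    (z : Fin d → ℂ) : quad E z = ∑ k, hE.eigenvalues k *
      ‖((hE.eigenvectorUnitary : Matrix (Fin d) (Fin d) ℂ)ᴴ *ᵥ z) k‖ ^ 2 := by
  set U := (hE.eigenvectorUnitary : Matrix (Fin d) (Fin d) ℂ) with hU
  have h := quad_mulVec (diagonal fun k => (hE.eigenvalues k : ℂ)) Uᴴ z
  rw [conjTranspose_conjTranspose, ← eq_mul_diagonal_eigenvalues_mul hE] at h
  rw [← h, quad, dotProduct, Complex.re_sum]
  refine Finset.sum_congr rfl fun k _ => ?_
  rw [mulVec_diagonal, Pi.star_apply, RCLike.star_def, mul_left_comm, Complex.conj_mul',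
    ← Complex.ofReal_pow, Complex.re_ofReal_mul, Complex.ofReal_re]

@[fun_prop]
theorem measurable_answer {d : ℕ} {E : Matrix (Fin d) (Fin d) ℂ} (hE : E.IsHermitian) :
    Measurable (answer hE) := by
  unfold answer mulVec dotProduct
  fun_prop

theorem answer_nonneg {d : ℕ} {E : Matrix (Fin d) (Fin d) ℂ} (hE : E.PosSemidef)
    (z : Fin d → ℂ) : 0 ≤ answer hE.isHermitian z :=
  Finset.sum_nonneg fun k _ => mul_nonneg (hE.eigenvalues_nonneg k) (threshold_nonneg _)

theorem answer_le_quad {d : ℕ} {E : Matrix (Fin d) (Fin d) ℂ} (hE : E.PosSemidef)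
    (z : Fin d → ℂ) : answer hE.isHermitian z ≤ quad E z := by
  rw [quad_eq_sum_eigenvalues hE.isHermitian]
  exact Finset.sum_le_sum fun k _ =>
    mul_le_mul_of_nonneg_left (threshold_le (by positivity)) (hE.eigenvalues_nonneg k)

theorem integrable_answer_mul_quad {d : ℕ} (hd : d ≠ 0) {E : Matrix (Fin d) (Fin d) ℂ}
    (hE : E.PosSemidef) (F : Matrix (Fin d) (Fin d) ℂ) :
    Integrable (fun z => answer hE.isHermitian z * quad F z) (haarVec d) := by
  refine integrable_haarVec hd (by fun_prop)
    ((∑ i, ∑ j, ‖E i j‖) * ∑ i, ∑ j, ‖F i j‖) fun z hz => ?_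
  rw [abs_mul, abs_of_nonneg (answer_nonneg hE z)]
  have h1 := (answer_le_quad hE z).trans ((le_abs_self _).trans (abs_quad_le E hz))
  exact mul_le_mul h1 (abs_quad_le F hz) (abs_nonneg _) ((answer_nonneg hE z).trans h1)

/-- The mean of `threshold t * (1 - t) / (d - 1)` for the overlap `t` of a random unit vector with
a fixed one: the weight with which the noise enters the correlations of the model. It is `0` by
convention if `d = 0`. -/
noncomputable def noiseWeight (d : ℕ) : ℝ :=
  if h : 0 < d then
    (∫ z : Fin d → ℂ, threshold d (‖z ⟨0, h⟩‖ ^ 2) * (1 - ‖z ⟨0, h⟩‖ ^ 2) ∂haarVec d) / (d - 1)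
  else 0

/-- Averaging the response over the hidden vector `z`, weighted by `⟨z|F|z⟩`, depends linearly on
the effect `E`, although the response itself does not. -/
theorem integral_answer_mul_quad {d : ℕ} (hd : 2 ≤ d) {E : Matrix (Fin d) (Fin d) ℂ}
    (hE : E.PosSemidef) (F : Matrix (Fin d) (Fin d) ℂ) :
    ∫ z, answer hE.isHermitian z * quad F z ∂haarVec d =
      localThreshold d / d * (E * F).trace.re + noiseWeight d * (E.trace.re * F.trace.re) := by
  have hd0 : d ≠ 0 := by omega
  have hdR : (2 : ℝ) ≤ d := by exact_mod_cast hd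
  set U := (hE.isHermitian.eigenvectorUnitary : Matrix (Fin d) (Fin d) ℂ) with hU
  have hUU : Uᴴ * U = 1 := conjTranspose_mul_eigenvectorUnitary hE.isHermitian
  have hUU' : U * Uᴴ = 1 := mul_eq_one_comm.1 hUU
  -- in the eigenbasis of `E`, only the overlaps with the coordinate axes matter
  rw [← integral_comp_mulVec_haarVec hUU (by fun_prop)]
  have h1 : ∀ z : Fin d → ℂ, answer hE.isHermitian (U *ᵥ z) * quad F (U *ᵥ z) =
      ∑ k, hE.isHermitian.eigenvalues k *
        (threshold d (‖z k‖ ^ 2) * quad (Uᴴ * F * U) z) := by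
    intro z
    rw [answer, ← hU, mulVec_mulVec, hUU, one_mulVec, quad_mulVec, Finset.sum_mul]
    exact Finset.sum_congr rfl fun k _ => by ring
  have hbound : ∀ t : ℝ, 0 ≤ t → t ≤ 1 → |threshold d t| ≤ 1 := fun t h0 h1 => by
    rw [abs_of_nonneg (threshold_nonneg t)]
    exact (threshold_le h0).trans h1
  have hint : ∀ k, Integrable (fun z => hE.isHermitian.eigenvalues k *
      (threshold d (‖z k‖ ^ 2) * quad (Uᴴ * F * U) z)) (haarVec d) := by
    intro k
    refine (integrable_haarVec hd0 (by fun_prop) (1 * ∑ i, ∑ j, ‖(Uᴴ * F * U) i j‖)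
      fun z hz => ?_).const_mul _
    rw [abs_mul]
    exact mul_le_mul (hbound _ (by positivity) (hz ▸ norm_sq_le_normSq z k)) (abs_quad_le _ hz)
      (abs_nonneg _) zero_le_one
  have hu : ∀ k, (∫ z : Fin d → ℂ, threshold d (‖z k‖ ^ 2) * (d * ‖z k‖ ^ 2 - 1) ∂haarVec d) /
      (d - 1) = localThreshold d / d := by
    intro k
    have h2 : ∀ z : Fin d → ℂ, threshold d (‖z k‖ ^ 2) * (d * ‖z k‖ ^ 2 - 1) =
        if 1 / (d : ℝ) < ‖z k‖ ^ 2 then (d * ‖z k‖ ^ 2 - 1) * ‖z k‖ ^ 2 else 0 := by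
      intro z
      unfold threshold
      split_ifs <;> ring
    simp only [h2]
    rw [integral_threshold (by omega) k, localThreshold]
    obtain ⟨n, rfl⟩ : ∃ n, d = n + 1 := ⟨d - 1, by omega⟩
    have h3 : ((n + 1 : ℕ) : ℝ) - 1 ≠ 0 := by linarith
    rw [Nat.add_sub_cancel, div_pow, pow_succ (((n + 1 : ℕ) : ℝ) - 1)]
    field_simp
  have hw : ∀ k, (∫ z : Fin d → ℂ, threshold d (‖z k‖ ^ 2) * (1 - ‖z k‖ ^ 2) ∂haarVec d) /
      (d - 1) = noiseWeight d := by
    intro k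
    have hd' : 0 < d := by omega
    have := integral_comp_perm_haarVec (Equiv.swap k ⟨0, hd'⟩)
      (f := fun z : Fin d → ℂ => threshold d (‖z k‖ ^ 2) * (1 - ‖z k‖ ^ 2)) (by fun_prop)
    rw [noiseWeight, dif_pos hd', ← this]
    simp
  simp only [h1]
  rw [integral_finsetSum _ fun k _ => hint k]
  simp only [integral_const_mul, integral_weight_mul_quad hd measurable_threshold hbound, hu, hw,
    trace_mul_eq_sum_eigenvalues hE.isHermitian, ← hU]
  have ht : (Uᴴ * F * U).trace = F.trace := by
    rw [trace_mul_comm, ← Matrix.mul_assoc, hUU', Matrix.one_mul]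
  have hE' : E.trace.re = ∑ k, hE.isHermitian.eigenvalues k := by
    rw [hE.isHermitian.trace_eq_sum_eigenvalues, Complex.re_sum]
    rfl
  rw [ht, hE', Finset.mul_sum, Finset.sum_mul, Finset.mul_sum, ← Finset.sum_add_distrib]
  exact Finset.sum_congr rfl fun k _ => by ring

/-- The response function of the first party, for a measurement with effects `E a` and a hidden
unit vector `z`: with the probabilities `s * answer (E a)`, else an outcome drawn with the
probabilities `Tr (E a) / d`. The factor `s` tunes the visibility. -/
noncomputable def alice {d : ℕ} {O : Type*} [Fintype O] (s : ℝ)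
    {E : O → Matrix (Fin d) (Fin d) ℂ} (hE : ∀ a, (E a).PosSemidef) (a : O) (z : Fin d → ℂ) : ℝ :=
  s * answer (hE a).isHermitian z +
    (E a).trace.re / d * (1 - s * ∑ b, answer (hE b).isHermitian z)

section alice

variable {d : ℕ} {O : Type*} [Fintype O] {s : ℝ} {E : O → Matrix (Fin d) (Fin d) ℂ}
  (hE : ∀ a, (E a).PosSemidef)

theorem measurable_alice (a : O) : Measurable (alice s hE a) := by
  unfold alice
  fun_prop

theorem alice_nonneg (hs0 : 0 ≤ s) (hs1 : s ≤ 1) (hsum : ∑ a, E a = 1) (a : O) {z : Fin d → ℂ}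
    (hz : normSq z = 1) : 0 ≤ alice s hE a z := by
  have h1 : ∑ b, answer (hE b).isHermitian z ≤ 1 := by
    rw [← quad_one hz, ← hsum, quad_sum]
    exact Finset.sum_le_sum fun b _ => answer_le_quad (hE b) z
  have h2 : 0 ≤ ∑ b, answer (hE b).isHermitian z :=
    Finset.sum_nonneg fun b _ => answer_nonneg (hE b) z
  have h3 : s * ∑ b, answer (hE b).isHermitian z ≤ 1 := mul_le_one₀ hs1 h2 h1
  have h4 : 0 ≤ (E a).trace.re := (Complex.le_def.1 (hE a).trace_nonneg).1
  exact add_nonneg (mul_nonneg hs0 (answer_nonneg (hE a) z))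
    (mul_nonneg (by positivity) (by linarith))

theorem sum_alice (hd : d ≠ 0) (hsum : ∑ a, E a = 1) (z : Fin d → ℂ) :
    ∑ a, alice s hE a z = 1 := by
  have h : ∑ a, (E a).trace.re = d := by
    rw [← Complex.re_sum, ← trace_sum, hsum, trace_one, Fintype.card_fin, Complex.natCast_re]
  have hd' : (d : ℝ) ≠ 0 := by exact_mod_cast hd
  simp only [alice, Finset.sum_add_distrib, ← Finset.mul_sum, ← Finset.sum_mul, ← Finset.sum_div]
  rw [h, div_self hd']
  ring

theorem integrable_alice_mul_quad (hd : d ≠ 0) (a : O) (F : Matrix (Fin d) (Fin d) ℂ) :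
    Integrable (fun z => alice s hE a z * quad F z) (haarVec d) := by
  have h1 : Integrable (quad F) (haarVec d) :=
    integrable_haarVec hd (by fun_prop) _ fun z hz => abs_quad_le F hz
  have h2 := fun b => integrable_answer_mul_quad hd (hE b) F
  have : (fun z => alice s hE a z * quad F z) = fun z =>
      s * (answer (hE a).isHermitian z * quad F z) + (E a).trace.re / d *
        (quad F z - s * ∑ b, answer (hE b).isHermitian z * quad F z) := by
    funext z
    rw [alice, ← Finset.sum_mul]
    ring
  rw [this]
  exact ((h2 a).const_mul _).add
    ((h1.sub ((integrable_finsetSum _ fun b _ => h2 b).const_mul _)).const_mul _)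

/-- The correlations of `alice` with `⟨z|F|z⟩`; the unknown `noiseWeight` cancels. -/
theorem integral_alice_mul_quad (hd : 2 ≤ d) (hsum : ∑ a, E a = 1) (a : O)
    (F : Matrix (Fin d) (Fin d) ℂ) :
    ∫ z, alice s hE a z * quad F z ∂haarVec d =
      s * localThreshold d / d * (E a * F).trace.re +
        (1 - s * localThreshold d) / d ^ 2 * ((E a).trace.re * F.trace.re) := by
  have hd0 : d ≠ 0 := by omega
  have hd' : (d : ℝ) ≠ 0 := by exact_mod_cast hd0
  have h1 : Integrable (quad F) (haarVec d) :=
    integrable_haarVec hd0 (by fun_prop) _ fun z hz => abs_quad_le F hz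
  have h2 := fun b => integrable_answer_mul_quad hd0 (hE b) F
  have h3 := integrable_finsetSum Finset.univ fun b _ => h2 b
  have h6 : Integrable (fun z => quad F z - s * ∑ b, answer (hE b).isHermitian z * quad F z)
      (haarVec d) := h1.sub (h3.const_mul _)
  have he : ∀ z, alice s hE a z * quad F z =
      s * (answer (hE a).isHermitian z * quad F z) + (E a).trace.re / d *
        (quad F z - s * ∑ b, answer (hE b).isHermitian z * quad F z) := by
    intro z
    rw [alice, ← Finset.sum_mul]
    ring
  simp only [he]
  rw [integral_add ((h2 a).const_mul _) (h6.const_mul _),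
    integral_const_mul, integral_const_mul, integral_sub h1 (h3.const_mul _), integral_const_mul,
    integral_finsetSum _ fun b _ => h2 b, integral_quad hd]
  simp only [fun b => integral_answer_mul_quad hd (hE b) F]
  have h4 : ∑ b, (E b * F).trace.re = F.trace.re := by
    rw [← Complex.re_sum, ← trace_sum, ← Matrix.sum_mul, hsum, Matrix.one_mul]
  have h5 : ∑ b, (E b).trace.re = d := by
    rw [← Complex.re_sum, ← trace_sum, hsum, trace_one, Fintype.card_fin, Complex.natCast_re]
  rw [Finset.sum_add_distrib, ← Finset.mul_sum, ← Finset.mul_sum, ← Finset.sum_mul, h4, h5]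
  field_simp
  ring

theorem integral_alice (hd : 2 ≤ d) (hsum : ∑ a, E a = 1) (a : O) :
    ∫ z, alice s hE a z ∂haarVec d = (E a).trace.re / d := by
  have hd0 : d ≠ 0 := by omega
  have hd' : (d : ℝ) ≠ 0 := by exact_mod_cast hd0
  have h := integral_alice_mul_quad (s := s) hE hd hsum a 1
  have h1 : ∫ z, alice s hE a z * quad 1 z ∂haarVec d = ∫ z, alice s hE a z ∂haarVec d := by
    refine integral_congr_ae ?_
    filter_upwards [ae_normSq_haarVec hd0] with z hz
    rw [quad_one hz, mul_one]
  rw [← h1, h, Matrix.mul_one, trace_one, Fintype.card_fin, Complex.natCast_re]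
  field_simp
  ring

end alice

/-! ### From two qudits to the two groups of parties -/

/-- The effect `V† (⨂ n, M n (a n)) V` on one qudit, for the isometry `V|i⟩ = |i⟩^{⊗ ι}`: it is the
entrywise product of the effects of the parties. -/
def groupEffect {ι : Type} [Fintype ι] {d : ℕ} (M : ι → POVM d)
    (a : (n : ι) → Fin (M n).outcomes) : Matrix (Fin d) (Fin d) ℂ :=
  Matrix.of fun i j => ∏ n, (M n).op (a n) i j

/-- The Schur product theorem, applied to all parties of the group. -/
theorem groupEffect_posSemidef {ι : Type} [Fintype ι] {d : ℕ} (M : ι → POVM d)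
    (a : (n : ι) → Fin (M n).outcomes) : (groupEffect M a).PosSemidef := by
  classical
  suffices h : ∀ s : Finset ι,
      (Matrix.of fun i j => ∏ n ∈ s, (M n).op (a n) i j : Matrix (Fin d) (Fin d) ℂ).PosSemidef from
    h Finset.univ
  intro s
  induction s using Finset.induction_on with
  | empty =>
    have h : (Matrix.of fun i j => ∏ m ∈ (∅ : Finset ι), (M m).op (a m) i j) =
        vecMulVec (fun _ : Fin d => (1 : ℂ)) (star fun _ => 1) := by
      ext i j
      simp [vecMulVec_apply]
    rw [h]
    exact posSemidef_vecMulVec_self_star _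
  | insert n s hn ih =>
    have h : (Matrix.of fun i j => ∏ m ∈ insert n s, (M m).op (a m) i j : Matrix _ _ ℂ) =
        (M n).op (a n) ⊙ Matrix.of fun i j => ∏ m ∈ s, (M m).op (a m) i j := by
      ext i j
      simp [Finset.prod_insert hn]
    rw [h]
    exact ((M n).posSemidef (a n)).hadamard ih

theorem sum_groupEffect {ι : Type} [Fintype ι] [DecidableEq ι] [Nonempty ι] {d : ℕ}
    (M : ι → POVM d) : ∑ a, groupEffect M a = 1 := by
  ext i j
  have h : ∀ n, ∑ b, (M n).op b i j = (1 : Matrix (Fin d) (Fin d) ℂ) i j := fun n => by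
    rw [← (M n).sum_eq_one, Matrix.sum_apply]
  rw [Matrix.sum_apply]
  simp only [groupEffect, of_apply]
  rw [← Fintype.prod_sum (fun n b => (M n).op b i j)]
  simp only [h, one_apply, Finset.prod_const, Finset.card_univ]
  split_ifs
  · exact one_pow _
  · exact zero_pow Fintype.card_ne_zero

theorem trace_measurementOp_mul_extend {N L d : ℕ} (M : Fin N → POVM d)
    (a : (n : Fin N) → Fin (M n).outcomes)
    (ρ : Matrix (Fin d × Fin d) (Fin d × Fin d) ℂ) :
    (measurementOp M a * extend N L ρ).trace =
      ((groupEffect (fun n : Group (cut N L) 0 => M n) (fun n => a n) ⊗ₖ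
        groupEffect (fun n : Group (cut N L) 1 => M n) (fun n => a n)) * ρ).trace := by
  have h : (cutIso N L d)ᴴ * measurementOp M a * cutIso N L d =
      groupEffect (fun n : Group (cut N L) 0 => M n) (fun n => a n) ⊗ₖ
        groupEffect (fun n : Group (cut N L) 1 => M n) (fun n => a n) := by
    ext x y
    have h1 : ((cutIso N L d)ᴴ * measurementOp M a * cutIso N L d) x y =
        measurementOp M a (cutPt N L x.1 x.2) (cutPt N L y.1 y.2) := by
      simp only [mul_apply, conjTranspose_apply, cutIso_apply, mul_ite, mul_one, mul_zero,
        Finset.sum_ite_eq', Finset.mem_univ, if_true]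
      rw [Finset.sum_eq_single (cutPt N L x.1 x.2)]
      · simp
      · intro z _ hz
        simp [hz]
      · simp
    rw [h1, kroneckerMap_apply]
    simp only [measurementOp, groupEffect, of_apply]
    rw [← Fintype.prod_fiberwise (cut N L), Fin.prod_univ_two]
    congr 1
    · refine Finset.prod_congr rfl fun n _ => ?_
      simp [cutPt, (cut_eq_zero_iff n.1).1 n.2]
    · refine Finset.prod_congr rfl fun n _ => ?_
      simp [cutPt, (cut_eq_one_iff n.1).1 n.2]
  rw [extend, ← Matrix.mul_assoc, trace_mul_comm, ← Matrix.mul_assoc, ← Matrix.mul_assoc, h]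

theorem trace_kronecker_mul_isotropic {d : ℕ} (E F : Matrix (Fin d) (Fin d) ℂ) (p : ℝ) :
    ((E ⊗ₖ F) * isotropic d p).trace =
      ((p / d : ℝ) : ℂ) * (E * Fᵀ).trace + (((1 - p) / d ^ 2 : ℝ) : ℂ) * (E.trace * F.trace) := by
  have h1 : ((E ⊗ₖ F) * proj (maxEnt d)).trace = ((1 / d : ℝ) : ℂ) * (E * Fᵀ).trace := by
    rw [maxEnt_eq, proj_smul, div_pow, one_pow, Real.sq_sqrt (Nat.cast_nonneg d), Matrix.mul_smul,
      trace_smul, Complex.real_smul]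
    congr 1
    simp only [trace, diag_apply, mul_apply, proj, vecMulVec_apply, kroneckerMap_apply,
      Pi.star_apply, Fintype.sum_prod_type, transpose_apply]
    simp
  rw [isotropic, Matrix.mul_add, trace_add, Matrix.mul_smul, Matrix.mul_smul, Matrix.mul_smul,
    trace_smul, trace_smul, trace_smul, h1, Matrix.mul_one, trace_kronecker]
  simp only [Complex.real_smul]
  push_cast
  ring

theorem trace_kronecker_mul_werner {d : ℕ} (E F : Matrix (Fin d) (Fin d) ℂ) (p : ℝ) :
    ((E ⊗ₖ F) * werner d p).trace =
      ((p / (d * (d - 1)) : ℝ) : ℂ) * (E.trace * F.trace - (E * F).trace) +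
        (((1 - p) / d ^ 2 : ℝ) : ℂ) * (E.trace * F.trace) := by
  have h1 : ((E ⊗ₖ F) * swapOp d).trace = (E * F).trace := by
    simp only [trace, diag_apply, mul_apply, swapOp, of_apply, kroneckerMap_apply]
    simp only [mul_ite, mul_one, mul_zero, Finset.sum_ite_eq', Finset.mem_univ, if_true,
      Prod.fst_swap, Prod.snd_swap, Fintype.sum_prod_type]
  rw [werner, asymProj, Matrix.mul_add, trace_add]
  simp only [Matrix.mul_smul, Matrix.mul_sub, trace_smul, trace_sub, h1, Matrix.mul_one,
    trace_kronecker, Complex.real_smul]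
  push_cast
  field_simp

/-- A two-qudit state whose statistics are reproduced by `alice` and a second response that is
additive in the effect extends to a state that is local across the cut. -/
theorem isLocalWrt_extend {N L d : ℕ} (hL : 1 ≤ L) (hLN : L + 1 ≤ N) (hd : 2 ≤ d)
    (ρ : Matrix (Fin d × Fin d) (Fin d × Fin d) ℂ) {s : ℝ} (hs0 : 0 ≤ s) (hs1 : s ≤ 1)
    (bob : Matrix (Fin d) (Fin d) ℂ → (Fin d → ℂ) → ℝ) (hbm : ∀ F, Measurable (bob F))
    (hb0 : ∀ F, F.PosSemidef → ∀ z, normSq z = 1 → 0 ≤ bob F z)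
    (hb1 : ∀ {O : Type} [Fintype O] (F : O → Matrix (Fin d) (Fin d) ℂ), ∑ a, F a = 1 →
      ∀ z, normSq z = 1 → ∑ a, bob (F a) z = 1)
    (hρ : ∀ {O : Type} [Fintype O] (E : O → Matrix (Fin d) (Fin d) ℂ)
      (hE : ∀ a, (E a).PosSemidef), ∑ a, E a = 1 → ∀ a F, F.PosSemidef →
      ((E a ⊗ₖ F) * ρ).trace = ((∫ z, alice s hE a z * bob F z ∂haarVec d : ℝ) : ℂ)) :
    IsLocalWrt (cut N L) (extend N L ρ) := by
  have hd0 : d ≠ 0 := by omega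
  have hS : MeasurableSet {z : Fin d → ℂ | normSq z = 1} :=
    measurableSet_eq_fun (by fun_prop) (by fun_prop)
  have h0 : Nonempty (Group (cut N L) 0) :=
    ⟨⟨⟨0, by omega⟩, (cut_eq_zero_iff _).2 (Nat.lt_of_succ_le hL)⟩⟩
  have h1 : Nonempty (Group (cut N L) 1) :=
    ⟨⟨⟨L, by omega⟩, (cut_eq_one_iff _).2 (by simp)⟩⟩
  have hres : (haarVec d).restrict {z | normSq z = 1} = haarVec d :=
    Measure.restrict_eq_self_of_ae_mem (ae_normSq_haarVec hd0)
  refine ⟨({z : Fin d → ℂ | normSq z = 1} : Set (Fin d → ℂ)), inferInstance,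
    (haarVec d).comap Subtype.val,
    fun k M a z => if k = 0 then alice s (fun b => groupEffect_posSemidef M b) a z.1
      else bob (groupEffect M a) z.1, ?_, ?_, ?_, ?_, ?_⟩
  · constructor
    rw [comap_subtype_coe_apply hS, Set.image_univ, Subtype.range_coe_subtype]
    exact (prob_compl_eq_zero_iff hS).1 (ae_normSq_haarVec hd0)
  · intro k M a
    dsimp only
    split_ifs
    · exact (measurable_alice _ a).comp measurable_subtype_coe
    · exact (hbm _).comp measurable_subtype_coe
  · intro k M a z
    dsimp only
    split_ifs with hk
    · subst hk
      exact alice_nonneg _ hs0 hs1 (sum_groupEffect M) a z.2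
    · exact hb0 _ (groupEffect_posSemidef M a) _ z.2
  · intro k M z
    dsimp only
    split_ifs with hk
    · subst hk
      exact sum_alice _ hd0 (sum_groupEffect M) z.1
    · obtain rfl : k = 1 := by omega
      exact hb1 _ (sum_groupEffect M) _ z.2
  · intro M a
    rw [trace_measurementOp_mul_extend, hρ (fun b => groupEffect _ b)
      (fun b => groupEffect_posSemidef _ b) (sum_groupEffect _) _ _ (groupEffect_posSemidef _ _)]
    congr 1
    simp only [Fin.prod_univ_two, if_true, one_ne_zero, if_false]
    rw [integral_subtype_comap hS (fun z => alice s (fun b => groupEffect_posSemidef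
      (fun n : Group (cut N L) 0 => M n) b) (fun n => a n) z *
        bob (groupEffect (fun n : Group (cut N L) 1 => M n) fun n => a n) z), hres]

theorem ofReal_re_trace {d : ℕ} {E : Matrix (Fin d) (Fin d) ℂ} (hE : E.IsHermitian) :
    ((E.trace.re : ℝ) : ℂ) = E.trace := by
  refine Complex.conj_eq_iff_re.1 ?_
  rw [← RCLike.star_def, ← trace_conjTranspose, hE.eq]

theorem ofReal_re_trace_mul {d : ℕ} {E F : Matrix (Fin d) (Fin d) ℂ} (hE : E.IsHermitian)
    (hF : F.IsHermitian) : (((E * F).trace.re : ℝ) : ℂ) = (E * F).trace := by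
  refine Complex.conj_eq_iff_re.1 ?_
  rw [← RCLike.star_def, ← trace_conjTranspose, conjTranspose_mul, hE.eq, hF.eq, trace_mul_comm]

/-- The second party answers according to the complex conjugate of the hidden vector. -/
theorem isLocalWrt_extend_isotropic {N L d : ℕ} (hL : 1 ≤ L) (hLN : L + 1 ≤ N) (hd : 2 ≤ d)
    {s : ℝ} (hs0 : 0 ≤ s) (hs1 : s ≤ 1) :
    IsLocalWrt (cut N L) (extend N L (isotropic d (s * localThreshold d))) := by
  refine isLocalWrt_extend hL hLN hd _ hs0 hs1 (fun F => quad Fᵀ)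
    (fun F => (continuous_quad _).measurable) (fun F hF z _ => quad_nonneg hF.transpose z)
    (fun F hF z hz => ?_) (fun E hE hsum a F hF => ?_)
  · rw [← quad_sum, ← transpose_sum, hF, transpose_one, quad_one hz]
  · rw [integral_alice_mul_quad hE hd hsum, trace_kronecker_mul_isotropic, trace_transpose]
    push_cast
    rw [ofReal_re_trace_mul (hE a).isHermitian hF.transpose.isHermitian,
      ofReal_re_trace (hE a).isHermitian, ofReal_re_trace hF.isHermitian]

/-- The second party answers according to the state `(1 - |z⟩⟨z|) / (d - 1)` orthogonal to the
hidden vector. -/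
theorem isLocalWrt_extend_werner {N L d : ℕ} (hL : 1 ≤ L) (hLN : L + 1 ≤ N) (hd : 2 ≤ d)
    {s : ℝ} (hs0 : 0 ≤ s) (hs1 : s ≤ 1) :
    IsLocalWrt (cut N L) (extend N L (werner d (s * localThreshold d))) := by
  have hdR : (2 : ℝ) ≤ d := by exact_mod_cast hd
  have hd1 : 0 < (d : ℝ) - 1 := by linarith
  refine isLocalWrt_extend hL hLN hd _ hs0 hs1 (fun F z => (F.trace.re - quad F z) / (d - 1))
    (fun F => by fun_prop) (fun F hF z hz => div_nonneg (sub_nonneg.2 ?_) hd1.le)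
    (fun F hF z hz => ?_) (fun E hE hsum a F hF => ?_)
  · have hU := conjTranspose_mul_eigenvectorUnitary hF.isHermitian
    have hz' : normSq ((hF.isHermitian.eigenvectorUnitary : Matrix (Fin d) (Fin d) ℂ)ᴴ *ᵥ z) =
        1 := by
      rw [normSq_mulVec (by rw [conjTranspose_conjTranspose]; exact mul_eq_one_comm.1 hU), hz]
    rw [quad_eq_sum_eigenvalues hF.isHermitian, hF.isHermitian.trace_eq_sum_eigenvalues,
      Complex.re_sum]
    refine Finset.sum_le_sum fun k _ => ?_
    exact mul_le_of_le_one_right (hF.eigenvalues_nonneg k) (hz' ▸ norm_sq_le_normSq _ k)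
  · rw [← Finset.sum_div, Finset.sum_sub_distrib, ← quad_sum, ← Complex.re_sum, ← trace_sum, hF,
      quad_one hz, trace_one, Fintype.card_fin, Complex.natCast_re, div_self hd1.ne']
  · have hi : ∫ z, alice s hE a z * ((F.trace.re - quad F z) / (d - 1)) ∂haarVec d =
        (F.trace.re * (∫ z, alice s hE a z ∂haarVec d) -
          ∫ z, alice s hE a z * quad F z ∂haarVec d) / (d - 1) := by
      have h1 : Integrable (fun z => alice s hE a z) (haarVec d) := by
        refine (integrable_alice_mul_quad (s := s) hE (by omega) a 1).congr ?_
        filter_upwards [ae_normSq_haarVec (by omega)] with z hz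
        rw [quad_one hz, mul_one]
      have h2 := integrable_alice_mul_quad (s := s) hE (by omega) a F
      rw [← integral_const_mul, ← integral_sub (h1.const_mul _) h2, ← integral_div]
      refine integral_congr_ae (Filter.Eventually.of_forall fun z => ?_)
      dsimp only
      ring
    have hdC : (d : ℂ) ≠ 0 := by
      have : d ≠ 0 := by omega
      exact_mod_cast this
    have hdC1 : (d : ℂ) - 1 ≠ 0 := by exact_mod_cast hd1.ne'
    rw [hi, integral_alice_mul_quad hE hd hsum, integral_alice hE hd hsum,
      trace_kronecker_mul_werner]
    push_cast
    rw [ofReal_re_trace_mul (hE a).isHermitian hF.isHermitian,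
      ofReal_re_trace (hE a).isHermitian, ofReal_re_trace hF.isHermitian]
    field_simp
    ring

/-! ### The threshold -/

theorem localThreshold_pos {d : ℕ} (hd : 2 ≤ d) : 0 < localThreshold d := by
  have hdR : (2 : ℝ) ≤ d := by exact_mod_cast hd
  have h1 : 0 < (d : ℝ) - 1 := by linarith
  have h2 : 0 < 3 * (d : ℝ) - 1 := by linarith
  unfold localThreshold
  positivity

/-- With `n = d - 1` the claim is `(1 + 1 / n) ^ n < 3 - 1 / (n + 1)`. The left side is less than
`e`, which settles all but `n = 1, 2`. -/
theorem one_div_lt_localThreshold {d : ℕ} (hd : 2 ≤ d) :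
    1 / ((d : ℝ) + 1) < localThreshold d := by
  obtain ⟨n, rfl⟩ : ∃ n, d = n + 1 := ⟨d - 1, by omega⟩
  have hn : (0 : ℝ) < n := by
    have : 0 < n := by omega
    exact_mod_cast this
  suffices h : ((n : ℝ) + 1) ^ (n + 1) < (3 * (n + 1) - 1) * (n : ℝ) ^ n by
    rw [localThreshold, Nat.add_sub_cancel]
    push_cast
    rw [div_lt_div_iff₀ (by positivity) (by positivity), add_sub_cancel_right, one_mul]
    exact mul_lt_mul_of_pos_right h (by positivity)
  by_cases h3 : n < 3
  · obtain rfl | rfl : n = 1 ∨ n = 2 := by omega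
    · norm_num
    · norm_num
  · have hn3 : (3 : ℝ) ≤ n := by exact_mod_cast not_lt.1 h3
    have h1 : (n : ℝ) + 1 ≤ n * Real.exp (1 / n) := by
      have := Real.add_one_le_exp (1 / (n : ℝ))
      calc (n : ℝ) + 1 = n * (1 / n + 1) := by
            rw [mul_add, mul_one_div_cancel hn.ne', mul_one, add_comm]
        _ ≤ _ := by gcongr
    have h2 : ((n : ℝ) + 1) ^ n ≤ n ^ n * Real.exp 1 := by
      calc ((n : ℝ) + 1) ^ n ≤ (n * Real.exp (1 / n)) ^ n := by gcongr
        _ = n ^ n * Real.exp 1 := by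
          rw [mul_pow, ← Real.exp_nat_mul, mul_one_div_cancel hn.ne']
    have h4 : Real.exp 1 * (n + 1) < 3 * (n + 1) - 1 := by
      nlinarith [Real.exp_one_lt_d9]
    calc ((n : ℝ) + 1) ^ (n + 1) = (n + 1) ^ n * (n + 1) := pow_succ _ _
      _ ≤ n ^ n * Real.exp 1 * (n + 1) := by gcongr
      _ = Real.exp 1 * (n + 1) * n ^ n := by ring
      _ < _ := mul_lt_mul_of_pos_right h4 (by positivity)

end Multipartite

theorem mainTheorem7 (N L d : ℕ) (hL : 1 ≤ L) (hLN : L + 1 ≤ N) (hd : 2 ≤ d) :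
    -- both families arise from the isotropic and the Werner states, and consist of states
    (∀ p : ℝ, 0 ≤ p → p ≤ 1 →
      Multipartite.ghzState N L d p =
          Multipartite.extend N L (Multipartite.isotropic d p) ∧
        Multipartite.wernerGenState N L d p =
          Multipartite.extend N L (Multipartite.werner d p) ∧
        Multipartite.IsDensity (Multipartite.ghzState N L d p) ∧
        Multipartite.IsDensity (Multipartite.wernerGenState N L d p)) ∧
    -- genuine multipartite entanglement
    (∀ p : ℝ, 1 / ((d : ℝ) + 1) < p → p ≤ 1 →
      Multipartite.IsGME (Multipartite.ghzState N L d p) ∧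
        Multipartite.IsGME (Multipartite.wernerGenState N L d p)) ∧
    -- bilocality across the cut
    (∀ p : ℝ, 0 ≤ p → p ≤ Multipartite.localThreshold d →
      Multipartite.IsLocalWrt (Multipartite.cut N L) (Multipartite.ghzState N L d p) ∧
        Multipartite.IsLocalWrt (Multipartite.cut N L) (Multipartite.wernerGenState N L d p)) ∧
    -- the two ranges overlap
    1 / ((d : ℝ) + 1) < Multipartite.localThreshold d := by
  have hcut : ∀ p : ℝ, 0 ≤ p → p ≤ Multipartite.localThreshold d →
      ∃ s : ℝ, 0 ≤ s ∧ s ≤ 1 ∧ p = s * Multipartite.localThreshold d := by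
    intro p h0 h1
    have hpos := Multipartite.localThreshold_pos hd
    exact ⟨p / Multipartite.localThreshold d, div_nonneg h0 hpos.le,
      (div_le_one hpos).2 h1, (div_mul_cancel₀ p hpos.ne').symm⟩
  have hdens : ∀ p : ℝ, 0 ≤ p → p ≤ 1 →
      Multipartite.IsDensity (Multipartite.ghzState N L d p) ∧
        Multipartite.IsDensity (Multipartite.wernerGenState N L d p) := by
    intro p h0 h1
    rw [Multipartite.ghzState_eq_extend, Multipartite.wernerGenState_eq_extend]
    exact ⟨(Multipartite.isDensity_isotropic hd h0 h1).extend hL hLN,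
      (Multipartite.isDensity_werner hd h0 h1).extend hL hLN⟩
  refine ⟨fun p h0 h1 => ⟨Multipartite.ghzState_eq_extend N L d p,
    Multipartite.wernerGenState_eq_extend N L d p, hdens p h0 h1⟩, fun p h0 h1 => ?_,
    fun p h0 h1 => ?_, Multipartite.one_div_lt_localThreshold hd⟩
  · have hp : 0 ≤ p := le_trans (by positivity) h0.le
    exact ⟨⟨(hdens p hp h1).1, fun K hK => Multipartite.not_isKSeparable_ghzState hL hLN hd h0 hK⟩,
      ⟨(hdens p hp h1).2,
        fun K hK => Multipartite.not_isKSeparable_wernerGenState hL hLN hd h0 hK⟩⟩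
  · obtain ⟨s, hs0, hs1, rfl⟩ := hcut p h0 h1
    rw [Multipartite.ghzState_eq_extend, Multipartite.wernerGenState_eq_extend]
    exact ⟨Multipartite.isLocalWrt_extend_isotropic hL hLN hd hs0 hs1,
      Multipartite.isLocalWrt_extend_werner hL hLN hd hs0 hs1⟩
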